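/- All graphs are finite and simple. A graph is locally irregular if any two adjacent vertices have distinct degrees. A decomposition of a graph $G$ is a collection $H_1,\dots,H_k$ of subgraphs of $G$ such that $E(H_1),\dots,E(H_k)$ form a partition of $E(G)$; it is locally irregular if every $H_i$ is locally irregular, and $G$ is decomposable if it has a locally irregular decomposition. For decomposable $G$, the irregular chromatic index $\chi'_{\rm irr}(G)$ is the smallest size $k$ of a locally irregular decomposition of $G$. **Theorem.** Let $G$ be a graph whose vertex set is partitioned into a maximal clique $X=\{v_1,\dots,v_n\}$ and a stable set $Y=V(G)\setminus X$, where $2\le n\le 9$. Let $d_i=|N_G(v_i)\cap Y|$ and suppose that $d_1\ge\cdots\ge d_n$. Then the following holds. (i) If $G$ is isomorphic to $K_2$, $K_3$ or $P_4$ (the path with four vertices), then $G$ is not decomposable. (ii) If $G$ is decomposable, then (a) if $d_1>d_2>\cdots>d_n$, then $\chi'_{\rm irr}(G)=1$; and, if $d_1>d_2>\cdots>d_n$ does not hold, (b) if $\sum_{i=1}^n d_i\ge\lfloor n/2\rfloor$, then $\chi'_{\rm irr}(G)=2$; (c) if $n\in\{8,9\}$, $d_1+d_2+d_3=3$ and $d_2\ge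 1$, then $\chi'_{\rm irr}(G)=2$; (d) if $n=9$ and $d_1=d_2=1$, then $\chi'_{\rm irr}(G)=2$; (e) if none of the conditions of (b), (c), (d) holds, then $\chi'_{\rm irr}(G)=3$. -/

import Mathlib

namespace SimpleGraph

/-- A subgraph is locally irregular if any two of its adjacent vertices have distinct degrees in
it. (On finite graphs `Set.ncard` of the neighbour set is the degree.) -/
def Subgraph.IsLocallyIrregular {V : Type*} {G : SimpleGraph V} (H : G.Subgraph) : Prop :=
  ∀ u v : V, H.Adj u v → (H.neighborSet u).ncard ≠ (H.neighborSet v).ncard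

/-- The subgraphs `H 0, …, H (k-1)` decompose `G`: their edge sets form a partition of the edge
set of `G`. -/
structure IsDecomposition {V : Type*} (G : SimpleGraph V) {k : ℕ} (H : Fin k → G.Subgraph) :
    Prop where
  nonempty : ∀ i, (H i).edgeSet.Nonempty
  disjoint : ∀ i j, i ≠ j → Disjoint (H i).edgeSet (H j).edgeSet
  iUnion_eq : ⋃ i, (H i).edgeSet = G.edgeSet

/-- `G` has a locally irregular decomposition of size `k`. -/
def HasLocallyIrregularDecomposition {V : Type*} (G : SimpleGraph V) (k : ℕ) : Prop :=
  ∃ H : Fin k → G.Subgraph, G.IsDecomposition H ∧ ∀ i, (H i).IsLocallyIrregular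

/-- `G` is decomposable if it admits a locally irregular decomposition. -/
def Decomposable {V : Type*} (G : SimpleGraph V) : Prop :=
  ∃ k : ℕ, G.HasLocallyIrregularDecomposition k

/-- The irregular chromatic index of a decomposable graph: the smallest size of a locally
irregular decomposition. (Only meaningful for decomposable graphs.) -/
noncomputable def irregularChromaticIndex {V : Type*} (G : SimpleGraph V) : ℕ :=
  sInf {k : ℕ | G.HasLocallyIrregularDecomposition k}

/-- `G(X, Y)` is a split graph: `X` is a maximal clique and its complement `Y` is a stable set. -/
structure IsSplit {V : Type*} (G : SimpleGraph V) (X Y : Set V) : Prop where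
  maximal_isClique : Maximal G.IsClique X
  isIndepSet : G.IsIndepSet Y
  eq_compl : Y = Xᶜ

/-- The number of neighbours of `v` in the set `Y`. -/
noncomputable def degreeInto {V : Type*} (G : SimpleGraph V) (v : V) (Y : Set V) : ℕ :=
  (G.neighborSet v ∩ Y).ncard

end SimpleGraph

/-!
Split the clique into vertices `x₀, …, xₕ₋₁` and `y₀, …, yₜ₋₁`, where `h ≤ t ≤ h + 1`. Colour the
edges at the first part red and those at the second part blue, except that an edge between `x_p` and
`y_q` is red exactly when `q ≤ p`. Then `x_p` has red degree `h + p + d(x_p)`, `y_q` has blue degree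
`t - 1 + q + d(y_q)`, and the two ends of a mixed edge always differ. So it suffices to arrange the
vertices such that the sums `p + d(x_p)` are distinct and positive, which is possible once they have
`h` or more neighbours in the stable set: this gives two colours for `⌊n / 2⌋ ≤ ∑ d i`. Below this
bound, a third colour on a path with two edges repairs the defect, and the exceptional graphs have
explicit two-colourings.

Conversely, the red degrees in a two-colouring are distinct on the vertices without neighbours in
the stable set, hence nearly exhaust `{1, …, n - 1}`, after exchanging the colours if `0` occurs.
Counting the red edges at the vertices of large and of small degree, as in the Erdős–Gallai
inequality, restricts the adjacencies of the one or two remaining vertices so much that no colouring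
is possible.
-/

namespace LocallyIrregular

open SimpleGraph

section Colorable

variable {V V' : Type*} {G : SimpleGraph V} {G' : SimpleGraph V'}

/-- A graph is locally irregular if adjacent vertices have distinct degrees. As in the notion for
subgraphs, the degree is the `Set.ncard` of the neighbour set. -/
def IsLocallyIrregular (G : SimpleGraph V) : Prop :=
  ∀ ⦃u w⦄, G.Adj u w → (G.neighborSet u).ncard ≠ (G.neighborSet w).ncard

/-- `G` is irregularly `k`-colourable if its edges can be coloured with (at most) `k` colours so
that every colour class is locally irregular. Unlike in a decomposition, empty classes are
allowed, which makes the notion monotone in `k`. -/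
def IrregularlyColorable (G : SimpleGraph V) (k : ℕ) : Prop :=
  ∃ C : G.EdgeLabeling (Fin k), ∀ a, IsLocallyIrregular (C.labelGraph a)

theorem irregularlyColorable_of_le {k l : ℕ} (hlk : l ≤ k)
    (h : G.HasLocallyIrregularDecomposition l) : IrregularlyColorable G k := by
  obtain ⟨H, hH, hirr⟩ := h
  have hcover (e : G.edgeSet) : ∃ i, (e : Sym2 V) ∈ (H i).edgeSet := by
    simpa only [← hH.iUnion_eq, Set.mem_iUnion] using e.2
  choose f hf using hcover
  let C : G.EdgeLabeling (Fin k) := fun e => (f e).castLE hlk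
  have hadj (i : Fin l) (u w : V) : (C.labelGraph (i.castLE hlk)).Adj u w ↔ (H i).Adj u w := by
    rw [EdgeLabeling.labelGraph_adj]
    refine ⟨fun ⟨huw, hi⟩ => ?_, fun huw => ⟨(H i).adj_sub huw, congrArg (Fin.castLE hlk) ?_⟩⟩
    · rw [← Fin.castLE_injective hlk hi]
      exact hf ⟨s(u, w), huw⟩
    · by_contra hne
      exact Set.disjoint_left.1 (hH.disjoint _ _ hne) (hf ⟨s(u, w), _⟩) huw
  refine ⟨C, fun a u w huw => ?_⟩
  obtain ⟨i, rfl⟩ : ∃ i : Fin l, i.castLE hlk = a :=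
    let ⟨he, ha⟩ := (EdgeLabeling.labelGraph_adj u w).1 huw
    ⟨f ⟨s(u, w), he⟩, ha⟩
  simpa only [neighborSet, Subgraph.neighborSet, hadj] using hirr i u w ((hadj i u w).1 huw)

theorem IrregularlyColorable.exists_le {k : ℕ} (h : IrregularlyColorable G k) :
    ∃ l ≤ k, G.HasLocallyIrregularDecomposition l := by
  classical
  obtain ⟨C, hC⟩ := h
  let used : Finset (Fin k) := {a | (C.labelGraph a).edgeSet.Nonempty}
  let colour (i : Fin used.card) : Fin k := used.equivFin.symm i
  have hcolour (i : Fin used.card) : (C.labelGraph (colour i)).edgeSet.Nonempty :=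
    (Finset.mem_filter.1 (used.equivFin.symm i).2).2
  refine ⟨used.card, card_finset_fin_le _,
    fun i => toSubgraph (C.labelGraph (colour i)) C.labelGraph_le,
    ⟨hcolour, fun i j hij => ?_, ?_⟩, fun i u w huw => hC (colour i) huw⟩
  · refine disjoint_edgeSet.2 (EdgeLabeling.pairwise_disjoint_labelGraph fun h => hij ?_)
    exact used.equivFin.symm.injective (Subtype.ext h)
  · refine Set.Subset.antisymm (Set.iUnion_subset fun i => Subgraph.edgeSet_subset _) ?_
    rintro ⟨u, w⟩ huw
    have hadj : (C.labelGraph (C ⟨s(u, w), huw⟩)).Adj u w :=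
      (EdgeLabeling.labelGraph_adj u w).2 ⟨huw, rfl⟩
    have hused : C ⟨s(u, w), huw⟩ ∈ used := Finset.mem_filter.2 ⟨Finset.mem_univ _, s(u, w), hadj⟩
    refine Set.mem_iUnion.2 ⟨used.equivFin ⟨_, hused⟩, ?_⟩
    change (C.labelGraph (used.equivFin.symm (used.equivFin ⟨_, hused⟩)).1).Adj u w
    rwa [Equiv.symm_apply_apply]

theorem irregularChromaticIndex_eq {k : ℕ} (h : IrregularlyColorable G (k + 1))
    (h' : ¬ IrregularlyColorable G k) : G.irregularChromaticIndex = k + 1 := by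
  obtain ⟨l, hl, hdec⟩ := h.exists_le
  have hmem : G.HasLocallyIrregularDecomposition G.irregularChromaticIndex :=
    Nat.sInf_mem (s := {j | G.HasLocallyIrregularDecomposition j}) ⟨l, hdec⟩
  refine le_antisymm ((Nat.sInf_le hdec).trans hl) (Nat.succ_le_of_lt (lt_of_not_ge fun hk => ?_))
  exact h' (irregularlyColorable_of_le hk hmem)

theorem not_irregularlyColorable_zero {u w : V} (h : G.Adj u w) : ¬ IrregularlyColorable G 0 :=
  fun ⟨C, _⟩ => (C ⟨s(u, w), h⟩).elim0

theorem irregularlyColorable_one_iff : IrregularlyColorable G 1 ↔ IsLocallyIrregular G := by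
  have hG (C : G.EdgeLabeling (Fin 1)) : C.labelGraph 0 = G := by
    simpa only [iSup_unique, Fin.default_eq_zero] using C.iSup_labelGraph
  refine ⟨fun ⟨C, hC⟩ => hG C ▸ hC 0, fun h => ⟨(default : G.EdgeLabeling (Fin 1)), fun a => ?_⟩⟩
  rwa [Subsingleton.elim a 0, hG]

theorem IsLocallyIrregular.edgeSet_nontrivial {u w : V} (hG : IsLocallyIrregular G)
    (h : G.Adj u w) : G.edgeSet.Nontrivial := by
  by_contra hsub
  rw [Set.not_nontrivial_iff] at hsub
  have hnbr {u w : V} (h : G.Adj u w) : G.neighborSet u = {w} := by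
    ext x
    exact ⟨fun hx => Sym2.congr_right.1 (hsub hx h), fun hx => hx ▸ h⟩
  exact hG h (by rw [hnbr h, hnbr h.symm, Set.ncard_singleton, Set.ncard_singleton])

theorem not_decomposable_of_encard_edgeSet_le {u w : V} (hcard : G.edgeSet.encard ≤ 3)
    (h : G.Adj u w) (hdeg : (G.neighborSet u).ncard = (G.neighborSet w).ncard) :
    ¬ G.Decomposable := by
  rintro ⟨k, hk⟩
  obtain ⟨C, hC⟩ := irregularlyColorable_of_le le_rfl hk
  have htwo (e : G.edgeSet) : 2 ≤ (C.labelGraph (C e)).edgeSet.encard := by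
    obtain ⟨⟨x, y⟩, hxy⟩ := e
    refine Order.add_one_le_of_lt (Set.one_lt_encard_iff_nontrivial.2 ?_)
    exact (hC _).edgeSet_nontrivial ((EdgeLabeling.labelGraph_adj x y).2 ⟨hxy, rfl⟩)
  have hsame (e f : G.edgeSet) : C e = C f := by
    by_contra hne
    have hdisj : Disjoint (C.labelGraph (C e)).edgeSet (C.labelGraph (C f)).edgeSet :=
      disjoint_edgeSet.2 (EdgeLabeling.pairwise_disjoint_labelGraph hne)
    have hfour : (2 + 2 : ℕ∞) ≤ 3 := calc
      _ ≤ _ := add_le_add (htwo e) (htwo f)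
      _ = _ := (Set.encard_union_eq hdisj).symm
      _ ≤ _ := Set.encard_le_encard (Set.union_subset (edgeSet_mono C.labelGraph_le)
        (edgeSet_mono C.labelGraph_le))
      _ ≤ _ := hcard
    revert hfour
    decide
  have hG : C.labelGraph (C ⟨s(u, w), h⟩) = G := by
    ext x y
    rw [EdgeLabeling.labelGraph_adj]
    exact ⟨fun ⟨hxy, _⟩ => hxy, fun hxy => ⟨hxy, hsame _ _⟩⟩
  exact (hG ▸ hC _) h hdeg

theorem not_decomposable_of_iso [Fintype V'] [DecidableRel G'.Adj] (φ : G ≃g G') {u w : V'}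
    (hcard : G'.edgeFinset.card ≤ 3) (h : G'.Adj u w) (hdeg : G'.degree u = G'.degree w) :
    ¬ G.Decomposable := by
  have hncard (x : V') : (G.neighborSet (φ.symm x)).ncard = G'.degree x := by
    rw [← card_neighborSet_eq_degree, ← Nat.card_eq_fintype_card, ← Nat.card_coe_set_eq]
    exact Nat.card_congr (φ.symm.mapNeighborSet x).symm
  refine not_decomposable_of_encard_edgeSet_le (u := φ.symm u) (w := φ.symm w) ?_
    (φ.symm.map_adj_iff.2 h) (by rw [hncard, hncard, hdeg])
  rw [Set.encard_congr φ.mapEdgeSet, ← coe_edgeFinset, Set.encard_coe_eq_coe_finsetCard]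
  exact_mod_cast hcard

theorem not_decomposable_of_iso_small
    (h : Nonempty (G ≃g completeGraph (Fin 2)) ∨ Nonempty (G ≃g completeGraph (Fin 3)) ∨
      Nonempty (G ≃g pathGraph 4)) : ¬ G.Decomposable := by
  rcases h with ⟨⟨φ⟩⟩ | ⟨⟨φ⟩⟩ | ⟨⟨φ⟩⟩
  · exact not_decomposable_of_iso φ (u := 0) (w := 1) (by decide) (by decide) (by decide)
  · exact not_decomposable_of_iso φ (u := 0) (w := 1) (by decide) (by decide) (by decide)
  · let : DecidableRel (pathGraph 4).Adj := fun _ _ => decidable_of_iff' _ pathGraph_adj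
    exact not_decomposable_of_iso φ (u := 1) (w := 2) (by decide +revert) (by decide) (by decide)

end Colorable

section Split

variable {V ι ι' κ : Type*} {G : SimpleGraph V} {Y : Set V} {v : ι → V} {d : ι → ℕ}

/-- `v` enumerates, without repetition, the clique of the split graph `G` with stable set `Y`, and
`v i` has `d i` neighbours in `Y`. The index type is arbitrary so that vertices can be relabelled
by an equivalence. -/
structure IsSplitEnum (G : SimpleGraph V) (Y : Set V) (v : ι → V) (d : ι → ℕ) : Prop where
  isSplit : G.IsSplit (Set.range v) Y
  injective : Function.Injective v
  degreeInto_eq : ∀ i, G.degreeInto (v i) Y = d i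

/-- The degree of the clique vertex `i` in colour `a` when the clique edge `ij` has colour `c i j`
and all `d i` edges from `i` to the stable set have colour `e i`. -/
def colourDegree [Fintype ι] [DecidableEq ι] [DecidableEq κ] (c : ι → ι → κ) (e : ι → κ)
    (d : ι → ℕ) (a : κ) (i : ι) : ℕ :=
  Finset.card {j | j ≠ i ∧ c i j = a} + if e i = a then d i else 0

namespace IsSplitEnum

theorem comp (hG : IsSplitEnum G Y v d) (σ : ι' ≃ ι) : IsSplitEnum G Y (v ∘ σ) (d ∘ σ) where
  isSplit := by simpa only [EquivLike.range_comp] using hG.isSplit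
  injective := hG.injective.comp σ.injective
  degreeInto_eq i := hG.degreeInto_eq (σ i)

theorem adj (hG : IsSplitEnum G Y v d) {i j : ι} (hij : i ≠ j) : G.Adj (v i) (v j) :=
  hG.isSplit.maximal_isClique.prop (Set.mem_range_self i) (Set.mem_range_self j)
    (hG.injective.ne hij)

theorem notMem (hG : IsSplitEnum G Y v d) (i : ι) : v i ∉ Y := by
  simp [hG.isSplit.eq_compl]

theorem exists_eq_or_mem (hG : IsSplitEnum G Y v d) (u : V) : (∃ i, v i = u) ∨ u ∈ Y := by
  rw [hG.isSplit.eq_compl]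
  exact em (u ∈ Set.range v)

theorem not_adj (hG : IsSplitEnum G Y v d) {y z : V} (hy : y ∈ Y) (hz : z ∈ Y) : ¬ G.Adj y z :=
  fun h => hG.isSplit.isIndepSet hy hz h.ne h

theorem exists_not_adj (hG : IsSplitEnum G Y v d) {y : V} (hy : y ∈ Y) : ∃ i, ¬ G.Adj (v i) y := by
  by_contra! hall
  have hclique : G.IsClique (insert y (Set.range v)) :=
    hG.isSplit.maximal_isClique.prop.insert (by rintro _ ⟨i, rfl⟩ _; exact (hall i).symm)
  obtain ⟨i, rfl⟩ := hG.isSplit.maximal_isClique.le_of_ge hclique (Set.subset_insert _ _)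
    (Set.mem_insert _ _)
  exact hG.notMem i hy

theorem one_le [Finite V] (hG : IsSplitEnum G Y v d) {i : ι} {y : V} (hy : y ∈ Y)
    (h : G.Adj (v i) y) : 1 ≤ d i := by
  rw [← hG.degreeInto_eq, degreeInto, Nat.one_le_iff_ne_zero, ← Nat.pos_iff_ne_zero, Set.ncard_pos]
  exact ⟨y, h, hy⟩

theorem two_le [Finite V] (hG : IsSplitEnum G Y v d) {i : ι} {y z : V} (hy : y ∈ Y) (hz : z ∈ Y)
    (hyz : y ≠ z) (hiy : G.Adj (v i) y) (hiz : G.Adj (v i) z) : 2 ≤ d i := by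
  rw [← hG.degreeInto_eq]
  exact (Set.one_lt_ncard (Set.toFinite _)).2 ⟨y, ⟨hiy, hy⟩, z, ⟨hiz, hz⟩, hyz⟩

theorem ncard_neighborSet [Finite V] (hG : IsSplitEnum G Y v d) (H : SimpleGraph V) (i : ι) :
    (H.neighborSet (v i)).ncard =
      ((H.comap v).neighborSet i).ncard + H.degreeInto (v i) Y := by
  have hX : H.neighborSet (v i) \ Y = v '' (H.comap v).neighborSet i := by
    ext u
    constructor
    · rintro ⟨hu, huY⟩
      obtain ⟨j, rfl⟩ := (hG.exists_eq_or_mem u).resolve_right huY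
      exact ⟨j, hu, rfl⟩
    · rintro ⟨j, hj, rfl⟩
      exact ⟨hj, hG.notMem j⟩
  rw [← Set.ncard_inter_add_ncard_sdiff_eq_ncard _ Y, hX,
    Set.ncard_image_of_injective _ hG.injective, add_comm, degreeInto]

theorem ncard_neighborSet_of_mem (hG : IsSplitEnum G Y v d) {H : SimpleGraph V} (hH : H ≤ G)
    {y : V} (hy : y ∈ Y) : (H.neighborSet y).ncard = {j | H.Adj (v j) y}.ncard := by
  rw [← Set.ncard_image_of_injective _ hG.injective]
  congr 1
  ext u
  constructor
  · intro hu
    obtain ⟨j, rfl⟩ := (hG.exists_eq_or_mem u).resolve_right fun huY => hG.not_adj hy huY (hH hu)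
    exact ⟨j, hu.symm, rfl⟩
  · rintro ⟨j, hj, rfl⟩
    exact hj.symm

theorem ncard_neighborSet_self [Finite V] [Finite ι] (hG : IsSplitEnum G Y v d) (i : ι) :
    (G.neighborSet (v i)).ncard = Nat.card ι - 1 + d i := by
  have hcompl : (G.comap v).neighborSet i = {i}ᶜ := by
    ext j
    exact ⟨fun h hji => h.ne (congrArg v hji.symm), fun h => hG.adj (Ne.symm h)⟩
  rw [hG.ncard_neighborSet, hG.degreeInto_eq, hcompl, Set.ncard_compl, Set.ncard_singleton]

theorem exists_eq_of_mem_edgeSet (hG : IsSplitEnum G Y v d) {f : Sym2 V} (hf : f ∈ G.edgeSet) :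
    (∃ i j, f = s(v i, v j)) ∨ ∃ i, ∃ y ∈ Y, f = s(v i, y) := by
  obtain ⟨x, y⟩ := f
  rcases hG.exists_eq_or_mem x with ⟨i, rfl⟩ | hx <;>
    rcases hG.exists_eq_or_mem y with ⟨j, rfl⟩ | hy
  · exact .inl ⟨i, j, rfl⟩
  · exact .inr ⟨i, y, hy, rfl⟩
  · exact .inr ⟨j, x, hx, Sym2.eq_swap⟩
  · exact absurd hf (hG.not_adj hx hy)

theorem exists_edgeLabeling (hG : IsSplitEnum G Y v d) {c : ι → ι → κ}
    (hc : ∀ i j, c i j = c j i) (e : ι → κ) :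
    ∃ C : G.EdgeLabeling κ, (∀ i j h, C.get (v i) (v j) h = c i j) ∧
      ∀ i, ∀ y ∈ Y, ∀ h, C.get (v i) y h = e i := by
  have hcolour (f : G.edgeSet) : ∃ a, (∀ i j, (f : Sym2 V) = s(v i, v j) → a = c i j) ∧
      ∀ i, ∀ y ∈ Y, (f : Sym2 V) = s(v i, y) → a = e i := by
    rcases hG.exists_eq_of_mem_edgeSet f.2 with ⟨i, j, hf⟩ | ⟨i, y, hy, hf⟩ <;> rw [hf]
    · refine ⟨c i j, fun i' j' h => ?_, fun i' y hy h => ?_⟩ <;>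
        rcases Sym2.eq_iff.1 h with ⟨hi, hj⟩ | ⟨hi, hj⟩
      · rw [hG.injective hi, hG.injective hj]
      · rw [hG.injective hi, hG.injective hj, hc]
      · exact absurd (hj ▸ hy) (hG.notMem j)
      · exact absurd (hi ▸ hy) (hG.notMem i)
    · refine ⟨e i, fun i' j' h => ?_, fun i' z hz h => ?_⟩ <;>
        rcases Sym2.eq_iff.1 h with ⟨hi, hj⟩ | ⟨hi, hj⟩
      · exact absurd (hj ▸ hy) (hG.notMem j')
      · exact absurd (hj ▸ hy) (hG.notMem i')
      · rw [hG.injective hi]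
      · exact absurd (hi ▸ hz) (hG.notMem i)
  choose C hCX hCY using hcolour
  exact ⟨C, fun i j h => hCX _ i j rfl, fun i y hy h => hCY _ i y hy rfl⟩

theorem ncard_neighborSet_eq_colourDegree [Finite V] [Fintype ι] [DecidableEq ι] [DecidableEq κ]
    (hG : IsSplitEnum G Y v d) {H : SimpleGraph V} {c : ι → ι → κ} {e : ι → κ} {a : κ}
    (hX : ∀ i j, H.Adj (v i) (v j) ↔ j ≠ i ∧ c i j = a)
    (hY : ∀ i, ∀ y ∈ Y, H.Adj (v i) y ↔ e i = a ∧ G.Adj (v i) y) (i : ι) :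
    (H.neighborSet (v i)).ncard = colourDegree c e d a i := by
  classical
  rw [hG.ncard_neighborSet, colourDegree]
  congr 1
  · rw [← Set.ncard_coe_finset]
    congr 1
    ext j
    simp [hX]
  · rw [← hG.degreeInto_eq, degreeInto, degreeInto, ← Set.ncard_empty (α := V), ← apply_ite]
    congr 1
    ext y
    by_cases hy : y ∈ Y <;> by_cases ha : e i = a <;> simp [hy, ha, hY]

theorem irregularlyColorable [Finite V] [Fintype ι] [DecidableEq ι] (hG : IsSplitEnum G Y v d)
    {k : ℕ} {c : ι → ι → Fin k} {e : ι → Fin k} (hc : ∀ i j, c i j = c j i)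
    (hX : ∀ i j, i ≠ j → colourDegree c e d (c i j) i ≠ colourDegree c e d (c i j) j)
    (hY : ∀ i, ∀ y ∈ Y, G.Adj (v i) y →
      {j | e j = e i ∧ G.Adj (v j) y}.ncard ≠ colourDegree c e d (e i) i) :
    IrregularlyColorable G k := by
  obtain ⟨C, hCX, hCY⟩ := hG.exists_edgeLabeling hc e
  have hadj (a : Fin k) (i j : ι) : (C.labelGraph a).Adj (v i) (v j) ↔ j ≠ i ∧ c i j = a := by
    rw [EdgeLabeling.labelGraph_adj]
    exact ⟨fun ⟨h, ha⟩ => ⟨(ne_of_apply_ne v h.ne).symm, (hCX i j h).symm.trans ha⟩,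
      fun ⟨hij, ha⟩ => ⟨hG.adj hij.symm, (hCX i j _).trans ha⟩⟩
  have hadjY (a : Fin k) (i : ι) {y : V} (hy : y ∈ Y) :
      (C.labelGraph a).Adj (v i) y ↔ e i = a ∧ G.Adj (v i) y := by
    rw [EdgeLabeling.labelGraph_adj]
    exact ⟨fun ⟨h, ha⟩ => ⟨(hCY i y hy h).symm.trans ha, h⟩,
      fun ⟨ha, h⟩ => ⟨h, (hCY i y hy h).trans ha⟩⟩
  have hdeg (a : Fin k) (i : ι) :
      ((C.labelGraph a).neighborSet (v i)).ncard = colourDegree c e d a i :=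
    hG.ncard_neighborSet_eq_colourDegree (hadj a) (fun i _ hy => hadjY a i hy) i
  have hdegY (i : ι) {y : V} (hy : y ∈ Y) : ((C.labelGraph (e i)).neighborSet y).ncard =
      {j | e j = e i ∧ G.Adj (v j) y}.ncard := by
    simp only [hG.ncard_neighborSet_of_mem C.labelGraph_le hy, hadjY _ _ hy]
  refine ⟨C, fun a u w huw => ?_⟩
  rcases hG.exists_eq_or_mem u with ⟨i, rfl⟩ | hu <;>
    rcases hG.exists_eq_or_mem w with ⟨j, rfl⟩ | hw
  · obtain ⟨hij, rfl⟩ := (hadj a i j).1 huw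
    rw [hdeg, hdeg]
    exact hX i j hij.symm
  · obtain ⟨rfl, h⟩ := (hadjY a i hw).1 huw
    rw [hdeg, hdegY i hw]
    exact (hY i w hw h).symm
  · obtain ⟨rfl, h⟩ := (hadjY a j hu).1 huw.symm
    rw [hdeg, hdegY j hu]
    exact hY j u hu h
  · exact absurd (C.labelGraph_le huw) (hG.not_adj hu hw)

theorem irregularlyColorable_of_lt [Finite V] [Fintype ι] [DecidableEq ι]
    (hG : IsSplitEnum G Y v d) {k : ℕ} {c : ι → ι → Fin k} {e : ι → Fin k}
    (hc : ∀ i j, c i j = c j i)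
    (hX : ∀ i j, i ≠ j → colourDegree c e d (c i j) i ≠ colourDegree c e d (c i j) j)
    (hY : ∀ i, 1 ≤ d i →
      Finset.card {j | e j = e i ∧ 1 ≤ d j} < colourDegree c e d (e i) i) :
    IrregularlyColorable G k := by
  refine hG.irregularlyColorable hc hX fun i y hy h => ?_
  refine (lt_of_le_of_lt ?_ (hY i (hG.one_le hy h))).ne
  rw [← Set.ncard_coe_finset, Finset.coe_filter_univ]
  exact Set.ncard_le_ncard fun j hj => ⟨hj.1, hG.one_le hy hj.2⟩

theorem irregularlyColorable_one [Finite V] [Finite ι] (hG : IsSplitEnum G Y v d)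
    (hd : Function.Injective d) : IrregularlyColorable G 1 := by
  classical
  have := Fintype.ofFinite ι
  have hdeg (a : Fin 1) (i : ι) :
      colourDegree (fun _ _ => 0) (fun _ => 0) d a i = Fintype.card ι - 1 + d i := by
    simp [colourDegree, Finset.filter_ne', Subsingleton.elim 0 a]
  refine hG.irregularlyColorable (c := fun _ _ => 0) (e := fun _ => 0) (fun _ _ => rfl)
    (fun i j hij => ?_) fun i y hy h => ?_
  · rw [hdeg, hdeg]
    exact fun h => hij (hd (Nat.add_left_cancel h))
  · obtain ⟨j, hj⟩ := hG.exists_not_adj hy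
    have hlt : {j | (0 : Fin 1) = 0 ∧ G.Adj (v j) y}.ncard < Fintype.card ι := by
      rw [← Nat.card_eq_fintype_card]
      exact Set.ncard_lt_card fun hall => hj ((hall ▸ Set.mem_univ j).2)
    have := hG.one_le hy h
    rw [hdeg]
    omega

theorem not_irregularlyColorable_one [Finite V] [Finite ι] (hG : IsSplitEnum G Y v d)
    {i j : ι} (hij : i ≠ j) (hd : d i = d j) : ¬ IrregularlyColorable G 1 := by
  rw [irregularlyColorable_one_iff]
  intro h
  exact h (hG.adj hij) (by rw [hG.ncard_neighborSet_self, hG.ncard_neighborSet_self, hd])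

end IsSplitEnum

end Split

section Arrangement

/-- The sums `p + a₀, (p + 1) + a₁, …` of the entries of `[a₀, a₁, …]` with their positions,
counted from `p`. -/
def positionSums : ℕ → List ℕ → List ℕ
  | _, [] => []
  | p, a :: l => (p + a) :: positionSums (p + 1) l

theorem positionSums_append (p : ℕ) (K L : List ℕ) :
    positionSums p (K ++ L) = positionSums p K ++ positionSums (p + K.length) L := by
  induction K generalizing p with
  | nil => rfl
  | cons a K ih => simp [positionSums, ih, add_assoc, add_comm 1]

theorem positionSums_replicate_zero (p z : ℕ) :
    positionSums p (List.replicate z 0) = List.range' p z := by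
  induction z generalizing p with
  | zero => rfl
  | succ z ih => simp [List.replicate_succ, positionSums, ih, List.range'_succ]

theorem length_positionSums (p : ℕ) (L : List ℕ) : (positionSums p L).length = L.length := by
  induction L generalizing p with
  | nil => rfl
  | cons a L ih => simp [positionSums, ih]

theorem getElem_positionSums (p : ℕ) (L : List ℕ) (i : ℕ) (hi : i < (positionSums p L).length) :
    (positionSums p L)[i] = p + i + L[i]'(by rwa [length_positionSums] at hi) := by
  induction L generalizing p i with
  | nil => simp [positionSums] at hi
  | cons a L ih => cases i with
    | zero => rfl
    | succ i => simp only [positionSums, List.getElem_cons_succ, ih, add_assoc, add_comm 1]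

theorem add_le_of_mem_positionSums {p b : ℕ} {L : List ℕ} (hL : ∀ a ∈ L, b ≤ a) {x : ℕ}
    (hx : x ∈ positionSums p L) : p + b ≤ x := by
  induction L generalizing p with
  | nil => simp [positionSums] at hx
  | cons a L ih =>
    rw [List.forall_mem_cons] at hL
    rcases List.mem_cons.1 hx with rfl | hx
    · exact Nat.add_le_add_left hL.1 p
    · have := ih hL.2 hx
      lia

theorem nodup_positionSums {p : ℕ} {L : List ℕ} (hL : L.Pairwise (· ≤ ·)) :
    (positionSums p L).Nodup := by
  induction L generalizing p with
  | nil => exact List.nodup_nil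
  | cons a L ih =>
    rw [List.pairwise_cons] at hL
    refine List.nodup_cons.2 ⟨fun hmem => ?_, ih hL.2⟩
    have := add_le_of_mem_positionSums hL.1 hmem
    lia

theorem nodup_positionSums_block {p b z : ℕ} {L : List ℕ} (hz : z < b)
    (hL : ((p + b) :: positionSums (p + 1 + z) L).Nodup)
    (hle : ∀ x ∈ positionSums (p + 1 + z) L, p + b ≤ x) :
    (p :: positionSums p (b :: (List.replicate z 0 ++ L))).Nodup := by
  have hperm : (p :: positionSums p (b :: (List.replicate z 0 ++ L))).Perm
      (List.range' p (z + 1) ++ (p + b) :: positionSums (p + 1 + z) L) := by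
    rw [positionSums, positionSums_append, positionSums_replicate_zero, List.length_replicate,
      List.range'_succ, List.cons_append]
    exact List.perm_middle.symm.cons p
  rw [hperm.nodup_iff, List.nodup_append]
  refine ⟨List.nodup_range', hL, fun x hx y hy => ?_⟩
  rw [List.mem_range'_1] at hx
  rcases List.mem_cons.1 hy with rfl | hy
  · lia
  · have := hle y hy
    lia

/-- The entries `b, 0, …, 0` (with `b - 1` zeros) at the positions `p, …, p + b - 1` have the sums
`p + b, p + 1, …, p + b - 1`. One such block is laid for each nonzero entry, in increasing order,
until the zeros run out. -/
theorem exists_perm_nodup_positionSums (p z : ℕ) (L : List ℕ) (hsort : L.Pairwise (· ≤ ·))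
    (hpos : ∀ a ∈ L, 1 ≤ a) (hsum : z + L.length ≤ L.sum) :
    ∃ K, K.Perm (List.replicate z 0 ++ L) ∧ (p :: positionSums p K).Nodup := by
  induction L generalizing p z with
  | nil =>
    obtain rfl : z = 0 := by simpa using hsum
    exact ⟨[], .rfl, List.nodup_singleton p⟩
  | cons b L ih =>
    rw [List.forall_mem_cons] at hpos
    rw [List.pairwise_cons] at hsort
    rw [List.length_cons, List.sum_cons] at hsum
    by_cases hz : z < b
    · have hle {x : ℕ} (hx : x ∈ positionSums (p + 1 + z) L) : p + 1 + z + b ≤ x :=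
        add_le_of_mem_positionSums hsort.1 hx
      refine ⟨b :: (List.replicate z 0 ++ L), List.perm_middle.symm, nodup_positionSums_block hz
        (List.nodup_cons.2 ⟨fun hx => ?_, nodup_positionSums hsort.2⟩) fun x hx => ?_⟩
      · have := hle hx
        lia
      · have := hle hx
        lia
    · obtain ⟨K, hperm, hK⟩ := ih (p + b) (z - (b - 1)) hsort.2 hpos.2 (by lia)
      have hb : p + 1 + (b - 1) = p + b := by lia
      refine ⟨b :: (List.replicate (b - 1) 0 ++ K), ?_, nodup_positionSums_block (by lia)
        (by rwa [hb]) fun x hx => ?_⟩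
      · refine .trans (.cons b ?_) List.perm_middle.symm
        rw [← Nat.add_sub_cancel' (show b - 1 ≤ z by lia), List.replicate_add, List.append_assoc]
        exact hperm.append_left _
      · rw [hb] at hx
        exact add_le_of_mem_positionSums (fun a _ => Nat.zero_le a) hx

theorem exists_comp_perm_of_ofFn_perm {α : Type*} [LinearOrder α] {h : ℕ} {f g : Fin h → α}
    (hfg : (List.ofFn f).Perm (List.ofFn g)) : ∃ σ : Equiv.Perm (Fin h), f = g ∘ σ := by
  have hsort : f ∘ Tuple.sort f = g ∘ Tuple.sort g :=
    List.ofFn_injective <| (((Equiv.Perm.ofFn_comp_perm _ f).trans hfg).trans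
      (Equiv.Perm.ofFn_comp_perm _ g).symm).eq_of_pairwise'
        (Tuple.monotone_sort f).sortedLE_ofFn.pairwise
        (Tuple.monotone_sort g).sortedLE_ofFn.pairwise
  refine ⟨(Tuple.sort f)⁻¹.trans (Tuple.sort g), ?_⟩
  ext p
  simpa using congrFun hsort ((Tuple.sort f)⁻¹ p)

theorem exists_perm_injective_add {h : ℕ} (d : Fin h → ℕ) (hd : h ≤ ∑ p, d p) :
    ∃ σ : Equiv.Perm (Fin h),
      Function.Injective (fun p : Fin h => (p : ℕ) + d (σ p)) ∧
        ∀ p : Fin h, (p : ℕ) + d (σ p) ≠ 0 := by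
  let L : List ℕ := ((List.ofFn d).filter (· ≠ 0)).insertionSort (· ≤ ·)
  have hLd : L.Perm ((List.ofFn d).filter (· ≠ 0)) := List.perm_insertionSort _ _
  have hzeros : (List.ofFn d).filter (· = 0) = List.replicate ((List.ofFn d).count 0) 0 := by
    simp [List.filter_eq]
  have hL : (List.replicate ((List.ofFn d).count 0) 0 ++ L).Perm (List.ofFn d) := by
    rw [← hzeros]
    refine (hLd.append_left _).trans ?_
    simpa using List.filter_append_perm (· = 0) (List.ofFn d)
  have hpos : ∀ a ∈ L, 1 ≤ a := fun a ha =>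
    Nat.one_le_iff_ne_zero.2 (by simpa using (List.mem_filter.1 (hLd.mem_iff.1 ha)).2)
  have hsum : (List.ofFn d).count 0 + L.length ≤ L.sum := by
    have hlength := hL.length_eq
    have htotal := hL.sum_eq
    simp only [List.length_append, List.length_replicate, List.length_ofFn, List.sum_append,
      List.sum_replicate, smul_zero, zero_add, List.sum_ofFn] at hlength htotal
    rwa [hlength, htotal]
  obtain ⟨K, hperm, hK⟩ := exists_perm_nodup_positionSums 0 _ L (List.pairwise_insertionSort _ _)
    hpos hsum
  obtain ⟨f, rfl⟩ : ∃ f : Fin h → ℕ, K = List.ofFn f := by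
    obtain rfl : K.length = h := by rw [(hperm.trans hL).length_eq, List.length_ofFn]
    exact ⟨K.get, K.ofFn_get.symm⟩
  obtain ⟨σ, rfl⟩ := exists_comp_perm_of_ofFn_perm (hperm.trans hL)
  have hlength (p : Fin h) : (p : ℕ) < (positionSums 0 (List.ofFn (d ∘ σ))).length := by
    simp [length_positionSums]
  have hget (p : Fin h) : (positionSums 0 (List.ofFn (d ∘ σ)))[(p : ℕ)]'(hlength p) =
      p + d (σ p) := by
    simp [getElem_positionSums]
  rw [List.nodup_cons] at hK
  refine ⟨σ, fun p q hpq => Fin.ext ?_, fun p hp => hK.1 ?_⟩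
  · exact (hK.2.getElem_inj_iff (hi := hlength p) (hj := hlength q)).1
      ((hget p).trans (hpq.trans (hget q).symm))
  · have hmem := List.getElem_mem (hlength p)
    rwa [hget, hp] at hmem

end Arrangement

section Threshold

variable {V : Type*} {G : SimpleGraph V} {Y : Set V} {h t : ℕ}

/-- The threshold colouring of the edges of a complete graph: colour `0` inside the first part,
colour `1` inside the second part, and colour `0` between `p` and `q` exactly when `q ≤ p`. -/
def thresholdColour : Fin h ⊕ Fin t → Fin h ⊕ Fin t → Fin 2
  | .inl _, .inl _ => 0
  | .inl p, .inr q => if (q : ℕ) ≤ p then 0 else 1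
  | .inr q, .inl p => if (q : ℕ) ≤ p then 0 else 1
  | .inr _, .inr _ => 1

/-- The colour of the edges to the stable set that accompanies `thresholdColour`. -/
def sideColour : Fin h ⊕ Fin t → Fin 2 :=
  Sum.elim (fun _ => 0) (fun _ => 1)

theorem thresholdColour_comm (i j : Fin h ⊕ Fin t) : thresholdColour i j = thresholdColour j i := by
  cases i <;> cases j <;> rfl

theorem card_filter_sum {α β : Type*} [Fintype α] [Fintype β] (P : α ⊕ β → Prop)
    [DecidablePred P] : Finset.card {i | P i} =
      Finset.card {a | P (.inl a)} + Finset.card {b | P (.inr b)} := by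
  simp only [Finset.card_filter, Fintype.sum_sum_type]

theorem card_filter_val_le (n m : ℕ) : Finset.card {i : Fin n | (i : ℕ) ≤ m} = min n (m + 1) := by
  simpa only [Nat.lt_succ_iff] using Fin.card_filter_val_lt (n := n) (m := m + 1)

theorem card_filter_le_val (n m : ℕ) : Finset.card {i : Fin n | m ≤ (i : ℕ)} = n - m := by
  have hlt := Fin.card_filter_val_lt (n := n) (m := m)
  have hadd := Finset.card_filter_add_card_filter_not (s := .univ) fun i : Fin n => (i : ℕ) < m
  simp only [not_lt, Finset.card_univ, Fintype.card_fin] at hadd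
  omega

theorem card_filter_lt_val (n m : ℕ) : Finset.card {i : Fin n | m < (i : ℕ)} = n - (m + 1) :=
  card_filter_le_val n (m + 1)

variable {d : Fin h ⊕ Fin t → ℕ}

theorem colourDegree_thresholdColour_inl_zero (hht : h ≤ t) (p : Fin h) :
    colourDegree thresholdColour sideColour d 0 (.inl p) = h + p + d (.inl p) := by
  have hp := p.2
  rw [colourDegree, card_filter_sum]
  simp only [ne_eq, Sum.inl.injEq, thresholdColour, and_true, Finset.filter_ne',
    Finset.mem_univ, Finset.card_erase_of_mem, Finset.card_univ, Fintype.card_fin, reduceCtorEq,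
    not_false_eq_true, ite_eq_left_iff, not_le, one_ne_zero, imp_false, not_lt, true_and,
    card_filter_val_le, sideColour, Sum.elim_inl, ↓reduceIte]
  omega

theorem colourDegree_thresholdColour_inl_one (p : Fin h) :
    colourDegree thresholdColour sideColour d 1 (.inl p) = t - (p + 1) := by
  rw [colourDegree, card_filter_sum]
  simp [thresholdColour, sideColour, card_filter_lt_val]

theorem colourDegree_thresholdColour_inr_zero (q : Fin t) :
    colourDegree thresholdColour sideColour d 0 (.inr q) = h - q := by
  rw [colourDegree, card_filter_sum]
  simp [thresholdColour, sideColour, card_filter_le_val]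

theorem colourDegree_thresholdColour_inr_one (hth : t ≤ h + 1) (q : Fin t) :
    colourDegree thresholdColour sideColour d 1 (.inr q) = t - 1 + q + d (.inr q) := by
  have hq := q.2
  rw [colourDegree, card_filter_sum]
  simp only [ne_eq, reduceCtorEq, not_false_eq_true, thresholdColour, ite_eq_right_iff,
    zero_ne_one, imp_false, not_le, true_and, Fin.card_filter_val_lt, Sum.inr.injEq, and_true,
    Finset.filter_ne', Finset.mem_univ, Finset.card_erase_of_mem, Finset.card_univ,
    Fintype.card_fin, sideColour, Sum.elim_inr, ↓reduceIte]
  omega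

theorem ncard_sideColour_zero (P : Fin h ⊕ Fin t → Prop) :
    {j | sideColour j = 0 ∧ P j}.ncard = {p | P (.inl p)}.ncard := by
  rw [← Set.ncard_image_of_injective {p | P (.inl p)} Sum.inl_injective]
  congr 1
  ext (p | q) <;> simp [sideColour]

theorem ncard_sideColour_one (P : Fin h ⊕ Fin t → Prop) :
    {j | sideColour j = 1 ∧ P j}.ncard = {q | P (.inr q)}.ncard := by
  rw [← Set.ncard_image_of_injective {q | P (.inr q)} Sum.inr_injective]
  congr 1
  ext (p | q) <;> simp [sideColour]

theorem colourDegree_thresholdColour_ne (hht : h ≤ t) (hth : t ≤ h + 1)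
    (hinj : Function.Injective fun p : Fin h => (p : ℕ) + d (.inl p))
    (hne : ∀ p : Fin h, (p : ℕ) + d (.inl p) ≠ 0) (hmono : Monotone (d ∘ Sum.inr))
    {i j : Fin h ⊕ Fin t} (hij : i ≠ j) :
    colourDegree thresholdColour sideColour d (thresholdColour i j) i ≠
      colourDegree thresholdColour sideColour d (thresholdColour i j) j := by
  have hinl_inr (p : Fin h) (q : Fin t) :
      colourDegree thresholdColour sideColour d (thresholdColour (.inl p) (.inr q)) (.inl p) ≠
        colourDegree thresholdColour sideColour d (thresholdColour (.inl p) (.inr q))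
          (.inr q) := by
    have hp := p.2
    simp only [thresholdColour]
    split_ifs with hqp
    · rw [colourDegree_thresholdColour_inl_zero hht, colourDegree_thresholdColour_inr_zero]
      have := hne p
      omega
    · rw [colourDegree_thresholdColour_inl_one, colourDegree_thresholdColour_inr_one hth]
      omega
  rcases i with p | q <;> rcases j with p' | q'
  · have hpp := hinj.ne (ne_of_apply_ne _ hij)
    simp only [thresholdColour, colourDegree_thresholdColour_inl_zero hht]
    omega
  · exact hinl_inr p q'
  · rw [thresholdColour_comm]
    exact (hinl_inr p' q).symm
  · simp only [thresholdColour, colourDegree_thresholdColour_inr_one hth]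
    rcases lt_or_gt_of_ne (ne_of_apply_ne _ hij) with hqq | hqq <;>
    · have := hmono hqq.le
      simp only [Function.comp_apply] at this
      omega

theorem IsSplitEnum.irregularlyColorable_two_of_injective [Finite V] {v : Fin h ⊕ Fin t → V}
    (hG : IsSplitEnum G Y v d) (hht : h ≤ t) (hth : t ≤ h + 1)
    (hinj : Function.Injective fun p : Fin h => (p : ℕ) + d (.inl p))
    (hne : ∀ p : Fin h, (p : ℕ) + d (.inl p) ≠ 0) (hmono : Monotone (d ∘ Sum.inr))
    (hY : ∀ y ∈ Y, (∀ q, G.Adj (v (.inr q)) y) → ∀ q, d (.inr q) ≠ 1) :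
    IrregularlyColorable G 2 := by
  refine hG.irregularlyColorable thresholdColour_comm
    (fun _ _ => colourDegree_thresholdColour_ne hht hth hinj hne hmono) ?_
  rintro (p | q) y hy hadj
  · change {j | sideColour j = 0 ∧ G.Adj (v j) y}.ncard ≠ colourDegree _ sideColour d 0 _
    have hle := Set.ncard_le_card {p | G.Adj (v (.inl p)) y}
    have := hne p
    rw [ncard_sideColour_zero, colourDegree_thresholdColour_inl_zero hht]
    rw [Nat.card_fin] at hle
    omega
  · change {j | sideColour j = 1 ∧ G.Adj (v j) y}.ncard ≠ colourDegree _ sideColour d 1 _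
    have hd := hG.one_le hy hadj
    rw [ncard_sideColour_one, colourDegree_thresholdColour_inr_one hth]
    by_cases hall : ∀ q, G.Adj (v (.inr q)) y
    · have hle := Set.ncard_le_card {q | G.Adj (v (.inr q)) y}
      have := hY y hy hall q
      rw [Nat.card_fin] at hle
      omega
    · have hlt : {q | G.Adj (v (.inr q)) y}.ncard < Nat.card (Fin t) :=
        Set.ncard_lt_card fun huniv => hall (Set.eq_univ_iff_forall.1 huniv)
      rw [Nat.card_fin] at hlt
      omega

end Threshold

section ManyEdges

variable {V : Type*} [Finite V] {G : SimpleGraph V} {Y : Set V} {h t : ℕ}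
  {v : Fin h ⊕ Fin t → V} {d : Fin h ⊕ Fin t → ℕ}

theorem le_sum_inl_of_one_le (hpos : ∀ p, 1 ≤ d (.inl p)) : h ≤ ∑ p, d (.inl p) := by
  simpa using Finset.card_nsmul_le_sum .univ (fun p => d (.inl p)) 1 fun p _ => hpos p

theorem le_sum_inl (hle : ∀ p q, d (.inr q) ≤ d (.inl p)) (hsum : h ≤ ∑ i, d i) :
    h ≤ ∑ p, d (.inl p) := by
  by_cases hpos : ∀ p, 1 ≤ d (.inl p)
  · exact le_sum_inl_of_one_le hpos
  · push Not at hpos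
    obtain ⟨p, hp⟩ := hpos
    have hinr (q) : d (.inr q) = 0 := by have := hle p q; omega
    simpa [hinr] using hsum

namespace IsSplitEnum

theorem irregularlyColorable_two_of_le_sum_inl (hG : IsSplitEnum G Y v d) (hht : h ≤ t)
    (hth : t ≤ h + 1) (hsum : h ≤ ∑ p, d (.inl p))
    (hY : ∀ y ∈ Y, (∀ q, G.Adj (v (.inr q)) y) → ∀ q, d (.inr q) ≠ 1) :
    IrregularlyColorable G 2 := by
  obtain ⟨σ, hinj, hne⟩ := exists_perm_injective_add (fun p => d (.inl p)) hsum
  let τ := Tuple.sort fun q => d (.inr q)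
  refine (hG.comp (σ.sumCongr τ)).irregularlyColorable_two_of_injective hht hth hinj hne
    (Tuple.monotone_sort fun q => d (.inr q)) fun y hy hadj q => hY y hy (fun q' => ?_) (τ q)
  simpa using hadj (τ.symm q')

theorem irregularlyColorable_two_of_le_sum (hG : IsSplitEnum G Y v d) (hht : h ≤ t)
    (hth : t ≤ h + 1) (ht : 2 ≤ t) (hle : ∀ p q, d (.inr q) ≤ d (.inl p))
    (hsum : h ≤ ∑ i, d i) : IrregularlyColorable G 2 := by
  by_cases hY : ∀ y ∈ Y, (∀ q, G.Adj (v (.inr q)) y) → ∀ q, d (.inr q) ≠ 1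
  · exact hG.irregularlyColorable_two_of_le_sum_inl hht hth (le_sum_inl hle hsum) hY
  push Not at hY
  obtain ⟨y, hy, hadj, q, hq⟩ := hY
  obtain ⟨p | q', hp⟩ := hG.exists_not_adj hy
  swap
  · exact absurd (hadj q') hp
  have hpos (i) : 1 ≤ d i := by
    rcases i with p' | q'
    · exact hq ▸ hle p' q
    · exact hG.one_le hy (hadj q')
  -- Exchange `q` with a vertex not adjacent to `y`.
  refine (hG.comp (Equiv.swap (.inl p) (.inr q))).irregularlyColorable_two_of_le_sum_inl hht hth
    (le_sum_inl_of_one_le fun p' => hpos _) fun z hz hzadj => ?_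
  have hpz : G.Adj (v (.inl p)) z := by simpa using hzadj q
  have hyz : y ≠ z := by rintro rfl; exact hp hpz
  have htwo (q') (hq' : q' ≠ q) : 2 ≤ d (.inr q') := by
    have hq'z := hzadj q'
    rw [Function.comp_apply, Equiv.swap_apply_of_ne_of_ne (by simp) (by simpa)] at hq'z
    exact hG.two_le hy hz hyz (hadj q') hq'z
  intro q'
  by_cases hq' : q' = q
  · have : Nontrivial (Fin t) := Fin.nontrivial_iff_two_le.2 ht
    obtain ⟨r, hr⟩ := exists_ne q
    have := htwo r hr
    have := hle p r
    rw [hq', Function.comp_apply, Equiv.swap_apply_right]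
    omega
  · have := htwo q' hq'
    rw [Function.comp_apply, Equiv.swap_apply_of_ne_of_ne (by simp) (by simpa)]
    omega

end IsSplitEnum

end ManyEdges

section FinSum

variable {V : Type*} [Finite V] {G : SimpleGraph V} {Y : Set V} {n : ℕ} {v : Fin n → V}
  {d : Fin n → ℕ}

theorem IsSplitEnum.irregularlyColorable_two (hG : IsSplitEnum G Y v d) (hd : Antitone d)
    (hn : 2 ≤ n) (hsum : n / 2 ≤ ∑ i, d i) (htwo : n = 2 → ∀ i, d i ≠ 1) :
    IrregularlyColorable G 2 := by
  obtain ⟨h, t, rfl, hht, hth⟩ : ∃ h t, n = h + t ∧ h ≤ t ∧ t ≤ h + 1 :=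
    ⟨n / 2, n - n / 2, by omega, by omega, by omega⟩
  have hG' := hG.comp finSumFinEquiv
  have hle (p : Fin h) (q : Fin t) :
      (d ∘ finSumFinEquiv) (.inr q) ≤ (d ∘ finSumFinEquiv) (.inl p) := by
    refine hd (Fin.le_def.2 ?_)
    simp only [finSumFinEquiv_apply_left, Fin.val_castAdd, finSumFinEquiv_apply_right,
      Fin.val_natAdd]
    omega
  have hsum' : h ≤ ∑ i, (d ∘ finSumFinEquiv) i := by
    simp only [Function.comp_apply, Equiv.sum_comp]
    omega
  rcases Nat.lt_or_ge t 2 with ht | ht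
  · exact hG'.irregularlyColorable_two_of_le_sum_inl hht hth (le_sum_inl hle hsum')
      fun y _ _ q => htwo (by omega) _
  · exact hG'.irregularlyColorable_two_of_le_sum hht hth ht hle hsum'

end FinSum

section FewEdges

variable {V : Type*} [Finite V] {G : SimpleGraph V} {Y : Set V} {h t : ℕ}
  {d : Fin h ⊕ Fin t → ℕ}

/-- The threshold colouring modified by giving the new colour `2` to the path with centre `inr 0`
and ends `inl 0` and `inl 1`. -/
def pathColour : Fin h ⊕ Fin t → Fin h ⊕ Fin t → Fin 3
  | .inl _, .inl _ => 0
  | .inl p, .inr q => if (q : ℕ) = 0 ∧ (p : ℕ) ≤ 1 then 2 else if (q : ℕ) ≤ p then 0 else 1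
  | .inr q, .inl p => if (q : ℕ) = 0 ∧ (p : ℕ) ≤ 1 then 2 else if (q : ℕ) ≤ p then 0 else 1
  | .inr _, .inr _ => 1

theorem pathColour_comm (i j : Fin h ⊕ Fin t) : pathColour i j = pathColour j i := by
  cases i <;> cases j <;> rfl

theorem pathColour_inl_inl (p p' : Fin h) :
    pathColour (.inl p : Fin h ⊕ Fin t) (.inl p') = 0 := rfl

theorem pathColour_inr_inr (q q' : Fin t) :
    pathColour (.inr q : Fin h ⊕ Fin t) (.inr q') = 1 := rfl

theorem pathColour_inl_inr_eq_zero_iff (p : Fin h) (q : Fin t) :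
    pathColour (.inl p) (.inr q) = 0 ↔ (q : ℕ) ≤ p ∧ ((p : ℕ) ≤ 1 → (q : ℕ) ≠ 0) := by
  simp only [pathColour]
  grind

theorem pathColour_inl_inr_eq_one_iff (p : Fin h) (q : Fin t) :
    pathColour (.inl p) (.inr q) = 1 ↔ (p : ℕ) < q := by
  simp only [pathColour]
  grind

theorem pathColour_inl_inr_eq_two_iff (p : Fin h) (q : Fin t) :
    pathColour (.inl p) (.inr q) = 2 ↔ (q : ℕ) = 0 ∧ (p : ℕ) ≤ 1 := by
  simp only [pathColour]
  grind

theorem colourDegree_pathColour_inl_zero (hht : h ≤ t) (p : Fin h) :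
    colourDegree pathColour (fun _ => 0) d 0 (.inl p) =
      h - 1 + p + d (.inl p) + if (p : ℕ) ≤ 1 then 0 else 1 := by
  have hp := p.2
  have hcard : Finset.card {q : Fin t | (q : ℕ) ≤ p ∧ ((p : ℕ) ≤ 1 → (q : ℕ) ≠ 0)} =
      p + if (p : ℕ) ≤ 1 then 0 else 1 := by
    split_ifs with hp1
    · interval_cases hpv : (p : ℕ)
      · simp
      · refine Finset.card_eq_one.2 ⟨⟨1, by lia⟩, ?_⟩
        ext q
        simp only [Finset.mem_filter_univ, Finset.mem_singleton, Fin.ext_iff]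
        lia
    · simp only [hp1, false_imp_iff, and_true, card_filter_val_le]
      lia
  rw [colourDegree, card_filter_sum]
  simp only [ne_eq, Sum.inl.injEq, pathColour_inl_inl, and_true, Finset.filter_ne',
    Finset.mem_univ, Finset.card_erase_of_mem, Finset.card_univ, Fintype.card_fin, reduceCtorEq,
    not_false_eq_true, pathColour_inl_inr_eq_zero_iff, true_and, ↓reduceIte]
  lia

theorem colourDegree_pathColour_inl_one (p : Fin h) :
    colourDegree pathColour (fun _ => 0) d 1 (.inl p) = t - (p + 1) := by
  rw [colourDegree, card_filter_sum]
  simp [pathColour_inl_inr_eq_one_iff, pathColour_inl_inl, card_filter_lt_val]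

theorem colourDegree_pathColour_inr_zero {q : Fin t} (hq : d (.inr q) = 0) :
    colourDegree pathColour (fun _ => 0) d 0 (.inr q) =
      h - if (q : ℕ) = 0 then 2 else (q : ℕ) := by
  have hcard : Finset.card {p : Fin h | (q : ℕ) ≤ p ∧ ((p : ℕ) ≤ 1 → (q : ℕ) ≠ 0)} =
      h - if (q : ℕ) = 0 then 2 else (q : ℕ) := by
    split_ifs with hq0
    · simp [hq0, card_filter_lt_val]
    · simp [hq0, card_filter_le_val]
  rw [colourDegree, card_filter_sum]
  simpa [pathColour_comm (.inr q), pathColour_inl_inr_eq_zero_iff, pathColour_inr_inr, hq]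

theorem colourDegree_pathColour_inr_one (hth : t ≤ h + 1) (q : Fin t) :
    colourDegree pathColour (fun _ => 0) d 1 (.inr q) = t - 1 + q := by
  have hq := q.2
  rw [colourDegree, card_filter_sum]
  simp only [ne_eq, reduceCtorEq, not_false_eq_true, pathColour_comm (.inr q) (.inl _),
    pathColour_inl_inr_eq_one_iff, true_and, Fin.card_filter_val_lt, Sum.inr.injEq,
    pathColour_inr_inr, and_true, Finset.filter_ne', Finset.mem_univ, Finset.card_erase_of_mem,
    Finset.card_univ, Fintype.card_fin, zero_ne_one, ↓reduceIte, add_zero]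
  lia

theorem colourDegree_pathColour_inl_two {p : Fin h} (hp : (p : ℕ) ≤ 1) (ht : 1 ≤ t) :
    colourDegree pathColour (fun _ => 0) d 2 (.inl p) = 1 := by
  have hcard : Finset.card {q : Fin t | (q : ℕ) = 0} = 1 := by
    simpa only [Nat.le_zero, zero_add, min_eq_right ht] using card_filter_val_le t 0
  rw [colourDegree, card_filter_sum]
  simp [pathColour_inl_inr_eq_two_iff, pathColour_inl_inl, hp, hcard]

theorem colourDegree_pathColour_inr_two (hh : 2 ≤ h) {q : Fin t} (hq : (q : ℕ) = 0) :
    colourDegree pathColour (fun _ => 0) d 2 (.inr q) = 2 := by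
  rw [colourDegree, card_filter_sum]
  simpa [pathColour_comm (.inr q) (.inl _), pathColour_inl_inr_eq_two_iff, pathColour_inr_inr, hq,
    card_filter_val_le] using hh

theorem colourDegree_pathColour_inl_ne_inr (hh : 2 ≤ h) (hht : h ≤ t) (hth : t ≤ h + 1)
    (p : Fin h) {q : Fin t} (hq : d (.inr q) = 0) :
    colourDegree pathColour (fun _ => 0) d (pathColour (.inl p) (.inr q)) (.inl p) ≠
      colourDegree pathColour (fun _ => 0) d (pathColour (.inl p) (.inr q)) (.inr q) := by
  rcases lt_or_ge (p : ℕ) q with hpq | hqp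
  · rw [(pathColour_inl_inr_eq_one_iff p q).2 hpq, colourDegree_pathColour_inl_one,
      colourDegree_pathColour_inr_one hth]
    lia
  by_cases hqp' : (q : ℕ) = 0 ∧ (p : ℕ) ≤ 1
  · rw [(pathColour_inl_inr_eq_two_iff p q).2 hqp',
      colourDegree_pathColour_inl_two hqp'.2 (by lia),
      colourDegree_pathColour_inr_two hh hqp'.1]
    decide
  · rw [(pathColour_inl_inr_eq_zero_iff p q).2 ⟨hqp, by lia⟩,
      colourDegree_pathColour_inl_zero hht, colourDegree_pathColour_inr_zero hq]
    split_ifs <;> lia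

theorem IsSplitEnum.irregularlyColorable_three_of_eq_zero {v : Fin h ⊕ Fin t → V}
    (hG : IsSplitEnum G Y v d) (hh : 2 ≤ h) (hht : h ≤ t) (hth : t ≤ h + 1)
    (hmono : Monotone fun p => d (.inl p)) (hzero : d (.inl ⟨0, by lia⟩) = 0)
    (hinr : ∀ q, d (.inr q) = 0) : IrregularlyColorable G 3 := by
  refine hG.irregularlyColorable_of_lt (e := fun _ => 0) pathColour_comm ?_ ?_
  · rintro (p | q) (p' | q') hij
    · rw [pathColour_inl_inl, colourDegree_pathColour_inl_zero hht,
        colourDegree_pathColour_inl_zero hht]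
      rcases lt_or_gt_of_ne (ne_of_apply_ne _ hij) with hpp | hpp <;>
      · have := hmono hpp.le
        split_ifs <;> lia
    · exact colourDegree_pathColour_inl_ne_inr hh hht hth p (hinr q')
    · rw [pathColour_comm]
      exact (colourDegree_pathColour_inl_ne_inr hh hht hth p' (hinr q)).symm
    · rw [pathColour_inr_inr, colourDegree_pathColour_inr_one hth,
        colourDegree_pathColour_inr_one hth]
      have := ne_of_apply_ne _ hij
      lia
  · rintro (p | q) hpos
    · have hp : p ≠ ⟨0, by lia⟩ := by rintro rfl; lia
      have hcard : Finset.card {j | (0 : Fin 3) = 0 ∧ 1 ≤ d j} < h := by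
        simpa [card_filter_sum, hinr] using
          Finset.card_lt_univ_of_notMem (s := {p | 1 ≤ d (.inl p)}) (x := ⟨0, by lia⟩)
            (by simp [hzero])
      rw [colourDegree_pathColour_inl_zero hht]
      rw [ne_eq, Fin.ext_iff] at hp
      lia
    · rw [hinr] at hpos
      lia

theorem eq_zero_of_sum_le {n : ℕ} {d : Fin n → ℕ} (hd : Antitone d) {i : Fin n}
    (hsum : ∑ j, d j ≤ i) : d i = 0 := by
  by_contra hi
  have hcard : (i : ℕ) + 1 ≤ ∑ j ∈ Finset.Iic i, d j := by
    simpa using Finset.card_nsmul_le_sum (.Iic i) d 1 fun j hj =>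
      (Nat.one_le_iff_ne_zero.2 hi).trans (hd (Finset.mem_Iic.1 hj))
  have := Finset.sum_le_sum_of_subset (f := d) (Finset.subset_univ (Finset.Iic i))
  lia

theorem IsSplitEnum.irregularlyColorable_three {n : ℕ} {v : Fin n → V} {d : Fin n → ℕ}
    (hG : IsSplitEnum G Y v d) (hd : Antitone d) (hn : 4 ≤ n) (hsum : ∑ i, d i < n / 2) :
    IrregularlyColorable G 3 := by
  obtain ⟨h, t, rfl, hht, hth⟩ : ∃ h t, n = h + t ∧ h ≤ t ∧ t ≤ h + 1 :=
    ⟨n / 2, n - n / 2, by lia, by lia, by lia⟩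
  refine (hG.comp ((Fin.revPerm.sumCongr (.refl _)).trans
    finSumFinEquiv)).irregularlyColorable_three_of_eq_zero (by lia) hht hth ?_ ?_ ?_
  · intro p p' hpp
    exact hd (by simpa [Fin.le_def] using by lia)
  · refine eq_zero_of_sum_le hd ?_
    simp only [Equiv.trans_apply, Equiv.sumCongr_apply, Equiv.coe_refl, Sum.map_inl,
      Fin.revPerm_apply, finSumFinEquiv_apply_left, Fin.val_castAdd, Fin.val_rev, zero_add]
    lia
  · refine fun q => eq_zero_of_sum_le hd ?_
    simp only [Equiv.trans_apply, Equiv.sumCongr_apply, Equiv.coe_refl, Sum.map_inr, id_eq,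
      finSumFinEquiv_apply_right, Fin.val_natAdd]
    lia

end FewEdges

section Exceptional

variable {V : Type*} [Finite V] {G : SimpleGraph V} {Y : Set V} {h t n : ℕ}

/-- The threshold colouring with the colours of the edges in `F` exchanged. It serves for the
exceptional split graphs that have two-colourings in spite of having few edges to the stable
set. -/
def flippedColour (F : Finset (Sym2 (Fin h ⊕ Fin t))) (i j : Fin h ⊕ Fin t) : Fin 2 :=
  if s(i, j) ∈ F then (thresholdColour i j).rev else thresholdColour i j

theorem flippedColour_comm (F : Finset (Sym2 (Fin h ⊕ Fin t))) (i j : Fin h ⊕ Fin t) :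
    flippedColour F i j = flippedColour F j i := by
  rw [flippedColour, flippedColour, thresholdColour_comm, Sym2.eq_swap]

theorem IsSplitEnum.irregularlyColorable_two_of_one_one_one (ht : t = 4 ∨ t = 5)
    {v : Fin (4 + t) → V}
    (hG : IsSplitEnum G Y v fun i => if (i : ℕ) < 3 then 1 else 0) :
    IrregularlyColorable G 2 := by
  rcases ht with rfl | rfl
  all_goals
    refine (hG.comp (finSumFinEquiv.trans
      (.trans (Equiv.swap 1 4) (Equiv.swap 2 5)))).irregularlyColorable_of_lt
      (c := flippedColour {s(.inl 0, .inl 1), s(.inl 0, .inr 2)})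
      (e := Sum.elim ![1, 0, 0, 0] fun q => if q = 1 then 1 else 0)
      (flippedColour_comm _) ?_ ?_ <;> decide +kernel

theorem IsSplitEnum.irregularlyColorable_two_of_two_one (ht : t = 4 ∨ t = 5)
    {v : Fin (4 + t) → V}
    (hG : IsSplitEnum G Y v fun i => 2 - i) :
    IrregularlyColorable G 2 := by
  rcases ht with rfl | rfl
  all_goals
    refine (hG.comp finSumFinEquiv).irregularlyColorable_of_lt
      (c := flippedColour {s(.inl 1, .inl 2)}) (e := fun _ => 0)
      (flippedColour_comm _) ?_ ?_ <;> decide +kernel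

theorem IsSplitEnum.irregularlyColorable_two_of_one_one {v : Fin (4 + 5) → V}
    (hG : IsSplitEnum G Y v fun i => if (i : ℕ) < 2 then 1 else 0) :
    IrregularlyColorable G 2 := by
  refine (hG.comp (finSumFinEquiv.trans
      (.trans (Equiv.swap 0 4) (Equiv.swap 1 5)))).irregularlyColorable_of_lt
    (c := flippedColour {s(.inl 1, .inr 4), s(.inl 2, .inr 0), s(.inl 2, .inr 2),
      s(.inl 2, .inr 4), s(.inr 0, .inr 3), s(.inr 1, .inr 3)})
    (e := fun i => if i = .inr 1 then 1 else 0)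
    (flippedColour_comm _) ?_ ?_ <;> decide +kernel

end Exceptional

section Profile

variable {ι : Type*} [Fintype ι] {R : SimpleGraph ι} [DecidableRel R.Adj]
  {d ρ : ι → ℕ}

/-- The trace that a locally irregular two-colouring of a split graph leaves on its clique: `R` is
the graph of the clique edges of the first colour, `ρ i` is the degree of `i` in the first colour
and `d i` is the number of neighbours of `i` in the stable set. -/
structure IsDegreeProfile (R : SimpleGraph ι) [DecidableRel R.Adj] (d ρ : ι → ℕ) : Prop where
  degree_le : ∀ i, R.degree i ≤ ρ i
  le_degree_add : ∀ i, ρ i ≤ R.degree i + d i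
  ne_of_adj : ∀ ⦃i j⦄, R.Adj i j → ρ i ≠ ρ j
  add_ne_of_not_adj : ∀ ⦃i j⦄, i ≠ j → ¬ R.Adj i j → ρ i + d j ≠ ρ j + d i

theorem sum_card_filter_adj_comm {α : Type*} (R : SimpleGraph α) [DecidableRel R.Adj]
    (A B : Finset α) :
    ∑ a ∈ A, Finset.card {b ∈ B | R.Adj a b} = ∑ b ∈ B, Finset.card {a ∈ A | R.Adj b a} :=
  (Finset.sum_card_bipartiteAbove_eq_sum_card_bipartiteBelow R.Adj).trans <|
    Finset.sum_congr rfl fun b _ => congrArg Finset.card <|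
      Finset.filter_congr fun a _ => R.adj_comm a b

theorem IsSplitEnum.exists_isDegreeProfile {V : Type*} [Finite V] {G : SimpleGraph V} {Y : Set V}
    {v : ι → V} (hG : IsSplitEnum G Y v d) (h : IrregularlyColorable G 2) :
    ∃ (R : SimpleGraph ι) (_ : DecidableRel R.Adj) (ρ : ι → ℕ), IsDegreeProfile R d ρ := by
  classical
  obtain ⟨C, hC⟩ := h
  have hdeg (i) : ((C.labelGraph 0).neighborSet (v i)).ncard =
      ((C.labelGraph 0).comap v).degree i + (C.labelGraph 0).degreeInto (v i) Y := by
    rw [hG.ncard_neighborSet, ← card_neighborSet_eq_degree, ← Nat.card_coe_set_eq,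
      Nat.card_eq_fintype_card]
  have hadj (x y) : G.Adj x y ↔ (C.labelGraph 0).Adj x y ∨ (C.labelGraph 1).Adj x y := by
    simp only [EdgeLabeling.labelGraph_adj, ← exists_or]
    exact ⟨fun h => ⟨h, by lia⟩, fun h => h.1⟩
  have hadd (i) : ((C.labelGraph 0).neighborSet (v i)).ncard +
      ((C.labelGraph 1).neighborSet (v i)).ncard = Fintype.card ι - 1 + d i := by
    rw [← Nat.card_eq_fintype_card, ← hG.ncard_neighborSet_self, ← Set.ncard_union_eq]
    · congr 1
      ext y
      exact (hadj _ _).symm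
    · exact Set.disjoint_left.2 fun y hy hy' =>
        (disjoint_left.1 (EdgeLabeling.pairwise_disjoint_labelGraph zero_ne_one)) _ _ hy hy'
  refine ⟨(C.labelGraph 0).comap v, inferInstance,
    fun i => ((C.labelGraph 0).neighborSet (v i)).ncard, fun i => ?_, fun i => ?_,
    fun i j hij => hC 0 hij, fun i j hij hnadj => ?_⟩
  · rw [hdeg]
    exact Nat.le_add_right _ _
  · rw [hdeg, ← hG.degreeInto_eq]
    exact Nat.add_le_add_left
      (Set.ncard_le_ncard (Set.inter_subset_inter_left _ fun _ h => C.labelGraph_le h)) _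
  · have := hC 1 (((hadj _ _).1 (hG.adj hij)).resolve_left hnadj)
    have := hadd i
    have := hadd j
    lia

variable [DecidableEq ι]

theorem IsDegreeProfile.compl (hρ : IsDegreeProfile R d ρ) :
    IsDegreeProfile Rᶜ d fun i => Fintype.card ι - 1 + d i - ρ i := by
  have hlt (i) : R.degree i < Fintype.card ι := R.degree_lt_card_verts i
  have hle (i) := hρ.degree_le i
  have hle' (i) := hρ.le_degree_add i
  refine ⟨fun i => ?_, fun i => ?_, fun i j hij => ?_, fun i j hij hadj => ?_⟩
  · have := hle' i
    rw [degree_compl]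
    lia
  · have := hle i
    have := hlt i
    rw [degree_compl]
    lia
  · rw [compl_adj] at hij
    have := hρ.add_ne_of_not_adj hij.1 hij.2
    have := hle' i
    have := hle' j
    have := hlt i
    have := hlt j
    lia
  · have := hρ.ne_of_adj (i := i) (j := j) (by simpa [compl_adj, hij] using hadj)
    have := hle' i
    have := hle' j
    have := hlt i
    have := hlt j
    lia

theorem sum_degree_add_le {A B : Finset ι} (hAB : Disjoint A B) :
    ∑ a ∈ A, R.degree a + ∑ s ∈ (A ∪ B)ᶜ, Finset.card {b ∈ B | R.Adj s b} ≤
      ∑ b ∈ B, R.degree b + A.card * (A.card - 1) +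
        ∑ s ∈ (A ∪ B)ᶜ, Finset.card {a ∈ A | R.Adj s a} := by
  have hdeg (x) : R.degree x = Finset.card {a ∈ A | R.Adj x a} +
      Finset.card {b ∈ B | R.Adj x b} + Finset.card {s ∈ (A ∪ B)ᶜ | R.Adj x s} := by
    rw [← R.card_neighborFinset_eq_degree, R.neighborFinset_eq_filter]
    simp only [Finset.card_filter]
    rw [← Finset.sum_union hAB, Finset.sum_add_sum_compl]
  have hAA : ∑ a ∈ A, Finset.card {a' ∈ A | R.Adj a a'} ≤ A.card * (A.card - 1) := by
    rw [← smul_eq_mul]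
    refine Finset.sum_le_card_nsmul _ _ _ fun a ha => ?_
    rw [← Finset.card_erase_of_mem ha]
    refine Finset.card_le_card fun a' ha' => ?_
    rw [Finset.mem_filter] at ha'
    exact Finset.mem_erase.2 ⟨ha'.2.ne', ha'.1⟩
  simp only [hdeg, Finset.sum_add_distrib]
  rw [sum_card_filter_adj_comm R A B, sum_card_filter_adj_comm R A (A ∪ B)ᶜ,
    sum_card_filter_adj_comm R B (A ∪ B)ᶜ]
  lia

end Profile

section Single

variable {ι : Type*} [Fintype ι] {R : SimpleGraph ι} [DecidableRel R.Adj]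
  {d ρ : ι → ℕ} {s : ι}

theorem sum_Ico_eq_sum_Ico_add_sq (n : ℕ) :
    ∑ x ∈ Finset.Ico (n - n / 2) n, x = ∑ x ∈ Finset.Ico 1 (n - n / 2), x + n / 2 * (n / 2) := by
  obtain ⟨p, q, rfl, hq⟩ : ∃ p q, n = p + q ∧ q = n / 2 := ⟨n - n / 2, n / 2, by lia, rfl⟩
  have hrange : ∑ x ∈ Finset.Ico 1 p, x = ∑ x ∈ Finset.range p, x := by
    cases p with
    | zero => rfl
    | succ p => rw [Finset.range_eq_Ico, Finset.sum_eq_sum_Ico_succ_bot p.succ_pos, zero_add]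
  rw [← hq, Nat.add_sub_cancel, hrange, Finset.sum_Ico_eq_sum_range, Nat.add_sub_cancel_left,
    Finset.sum_add_distrib, Finset.sum_const, Finset.card_range, smul_eq_mul]
  obtain rfl | rfl : p = q ∨ p = q + 1 := by lia
  · exact add_comm _ _
  · rw [Finset.sum_range_succ]
    ring

theorem IsDegreeProfile.eq_degree (hρ : IsDegreeProfile R d ρ) {i : ι} (hi : d i = 0) :
    ρ i = R.degree i :=
  le_antisymm (by simpa [hi] using hρ.le_degree_add i) (hρ.degree_le i)

theorem IsDegreeProfile.injOn (hρ : IsDegreeProfile R d ρ) : Set.InjOn ρ {i | d i = 0} := by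
  intro i hi j hj hij
  by_contra hne
  by_cases hadj : R.Adj i j
  · exact hρ.ne_of_adj hadj hij
  · exact hρ.add_ne_of_not_adj hne hadj (by rw [hij, hi, hj])

theorem IsDegreeProfile.card_filter_image (hρ : IsDegreeProfile R d ρ) {U : Finset ι}
    (hU : ∀ i ∈ U, d i = 0) (p : ℕ → Prop) [DecidablePred p] :
    Finset.card {x ∈ U.image ρ | p x} = Finset.card {i ∈ U | p (ρ i)} := by
  rw [Finset.filter_image, Finset.card_image_of_injOn]
  exact hρ.injOn.mono fun i hi => hU i (Finset.mem_of_mem_filter i hi)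

theorem IsDegreeProfile.sum_filter_image (hρ : IsDegreeProfile R d ρ) {U : Finset ι}
    (hU : ∀ i ∈ U, d i = 0) (p : ℕ → Prop) [DecidablePred p] :
    ∑ x ∈ U.image ρ with p x, x = ∑ i ∈ U with p (ρ i), R.degree i := by
  rw [Finset.filter_image, Finset.sum_image]
  · exact Finset.sum_congr rfl fun i hi => hρ.eq_degree (hU i (Finset.mem_of_mem_filter i hi))
  · exact hρ.injOn.mono fun i hi => hU i (Finset.mem_of_mem_filter i hi)

theorem IsDegreeProfile.one_le_compl [Nontrivial ι] (hρ : IsDegreeProfile R d ρ) {w i : ι}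
    (hw : ρ w = 0) (hi : d i = 0) : 1 ≤ Fintype.card ι - 1 + d i - ρ i := by
  have hdeg : R.degree w = 0 := Nat.le_zero.1 (hw ▸ hρ.degree_le w)
  have hlt := (R.degree_lt_card_sub_one i).2
    (IsIsolated.not_isUniversal ((R.degree_eq_zero w).1 hdeg) i)
  rw [hρ.eq_degree hi]
  lia

theorem IsDegreeProfile.image_eq_Ico [DecidableEq ι] (hρ : IsDegreeProfile R d ρ)
    (hd : ∀ i ≠ s, d i = 0) (hpos : ∀ i ≠ s, 1 ≤ ρ i) :
    (Finset.univ.erase s).image ρ = Finset.Ico 1 (Fintype.card ι) := by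
  refine Finset.eq_of_subset_of_card_le (fun x hx => ?_) ?_
  · obtain ⟨i, hi, rfl⟩ := Finset.mem_image.1 hx
    have hi' := Finset.ne_of_mem_erase hi
    rw [Finset.mem_Ico]
    exact ⟨hpos i hi', (hρ.eq_degree (hd i hi')).trans_lt (R.degree_lt_card_verts i)⟩
  · rw [Finset.card_image_of_injOn (hρ.injOn.mono fun i hi => hd i (Finset.ne_of_mem_erase hi))]
    simp

theorem IsDegreeProfile.sum_filter_degree [DecidableEq ι] (hρ : IsDegreeProfile R d ρ)
    (hd : ∀ i ≠ s, d i = 0) (hpos : ∀ i ≠ s, 1 ≤ ρ i) (p : ℕ → Prop) [DecidablePred p] :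
    ∑ i ∈ Finset.univ.erase s with p (ρ i), R.degree i =
      ∑ x ∈ Finset.Ico 1 (Fintype.card ι) with p x, x := by
  rw [← hρ.image_eq_Ico hd hpos,
    hρ.sum_filter_image (fun i hi => hd i (Finset.ne_of_mem_erase hi)) p]

theorem IsDegreeProfile.card_filter_le [DecidableEq ι] (hρ : IsDegreeProfile R d ρ)
    (hd : ∀ i ≠ s, d i = 0) (hpos : ∀ i ≠ s, 1 ≤ ρ i) {m : ℕ} (hm : 1 ≤ m) :
    Finset.card {i ∈ Finset.univ.erase s | m ≤ ρ i} = Fintype.card ι - m := by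
  rw [← hρ.card_filter_image (fun i hi => hd i (Finset.ne_of_mem_erase hi)) (m ≤ ·),
    hρ.image_eq_Ico hd hpos, Finset.Ico_filter_le, max_eq_right hm, Nat.card_Ico]

theorem IsDegreeProfile.sum_degree_eq [DecidableEq ι] (hρ : IsDegreeProfile R d ρ)
    (hd : ∀ i ≠ s, d i = 0) (hpos : ∀ i ≠ s, 1 ≤ ρ i) {n : ℕ} (hn : Fintype.card ι = n) :
    ∑ i ∈ Finset.univ.erase s with n - n / 2 ≤ ρ i, R.degree i =
      ∑ i ∈ Finset.univ.erase s with ¬ n - n / 2 ≤ ρ i, R.degree i + n / 2 * (n / 2) := by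
  have hnpos : 1 ≤ n := hn ▸ Fintype.card_pos_iff.2 ⟨s⟩
  rw [hρ.sum_filter_degree hd hpos (n - n / 2 ≤ ·), hρ.sum_filter_degree hd hpos (¬ n - n / 2 ≤ ·)]
  simp only [not_le]
  rw [hn, Finset.Ico_filter_le, Finset.Ico_filter_lt, max_eq_right (by lia),
    min_eq_right (Nat.sub_le _ _), sum_Ico_eq_sum_Ico_add_sq]

theorem IsDegreeProfile.neighborFinset_eq [DecidableEq ι] (hρ : IsDegreeProfile R d ρ)
    (hd : ∀ i ≠ s, d i = 0) (hpos : ∀ i ≠ s, 1 ≤ ρ i) :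
    R.neighborFinset s =
      {i ∈ Finset.univ.erase s | Fintype.card ι - Fintype.card ι / 2 ≤ ρ i} := by
  set n := Fintype.card ι
  have hnpos : 1 ≤ n := Fintype.card_pos_iff.2 ⟨s⟩
  set A : Finset ι := {i ∈ Finset.univ.erase s | n - n / 2 ≤ ρ i} with hA
  set B : Finset ι := {i ∈ Finset.univ.erase s | ¬ n - n / 2 ≤ ρ i}
  have hAcard : A.card = n / 2 := by
    rw [hA, hρ.card_filter_le hd hpos (by lia)]
    lia
  have hcompl : (A ∪ B)ᶜ = {s} := by
    rw [Finset.filter_union_filter_not_eq, ← Finset.sdiff_singleton_eq_erase,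
      ← Finset.compl_eq_univ_sdiff, compl_compl]
  have hEG := sum_degree_add_le (R := R) (Finset.disjoint_filter_filter_not (Finset.univ.erase s)
    (Finset.univ.erase s) fun i => n - n / 2 ≤ ρ i)
  rw [hcompl, Finset.sum_singleton, Finset.sum_singleton, hρ.sum_degree_eq hd hpos rfl,
    hAcard] at hEG
  have hle : Finset.card {a ∈ A | R.Adj s a} ≤ A.card := Finset.card_filter_le _ _
  have hsub : n / 2 * (n / 2 - 1) + n / 2 = n / 2 * (n / 2) := by
    rw [← Nat.mul_add_one]
    rcases Nat.eq_zero_or_pos (n / 2) with h | h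
    · rw [h, zero_mul, zero_mul]
    · rw [Nat.sub_add_cancel h]
  have hAadj : ∀ a ∈ A, R.Adj s a := by
    rw [← Finset.filter_eq_self]
    exact Finset.eq_of_subset_of_card_le (Finset.filter_subset _ _) (by lia)
  have hBadj : ∀ b ∈ B, ¬ R.Adj s b := by
    rw [← Finset.filter_eq_empty_iff, ← Finset.card_eq_zero]
    lia
  ext i
  rw [mem_neighborFinset]
  refine ⟨fun hi => ?_, hAadj i⟩
  by_contra hiA
  exact hBadj i (Finset.mem_filter.2 ⟨Finset.mem_erase.2 ⟨hi.ne', Finset.mem_univ i⟩, fun h =>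
    hiA (Finset.mem_filter.2 ⟨Finset.mem_erase.2 ⟨hi.ne', Finset.mem_univ i⟩, h⟩)⟩) hi

theorem IsDegreeProfile.false_of_one_le (hρ : IsDegreeProfile R d ρ) (hd : ∀ i ≠ s, d i = 0)
    (hs : d s < Fintype.card ι / 2) (hpos : ∀ i ≠ s, 1 ≤ ρ i) : False := by
  classical
  have hexists {x : ℕ} (hx : 1 ≤ x) (hxn : x < Fintype.card ι) : ∃ i, i ≠ s ∧ ρ i = x := by
    have hmem := Finset.mem_Ico.2 ⟨hx, hxn⟩
    rw [← hρ.image_eq_Ico hd hpos, Finset.mem_image] at hmem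
    obtain ⟨i, hi, rfl⟩ := hmem
    exact ⟨i, Finset.ne_of_mem_erase hi, rfl⟩
  have hdeg : R.degree s = Fintype.card ι / 2 := by
    rw [← R.card_neighborFinset_eq_degree, hρ.neighborFinset_eq hd hpos,
      hρ.card_filter_le hd hpos (by lia)]
    lia
  have hadj {i} (hi : i ≠ s) : R.Adj s i ↔ Fintype.card ι - Fintype.card ι / 2 ≤ ρ i := by
    rw [← R.mem_neighborFinset, hρ.neighborFinset_eq hd hpos]
    simp [hi]
  have hle := hρ.degree_le s
  have hle' := hρ.le_degree_add s
  rcases lt_or_ge (ρ s) (Fintype.card ι - Fintype.card ι / 2) with hlt | hge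
  · obtain ⟨i, hi, hix⟩ := hexists (x := ρ s - d s) (by lia) (by lia)
    have hnadj := (hadj hi).not.2 (by lia)
    exact hρ.add_ne_of_not_adj hi.symm hnadj (by rw [hd i hi]; lia)
  · obtain ⟨i, hi, hix⟩ := hexists (x := ρ s) (by lia) (by lia)
    exact hρ.ne_of_adj ((hadj hi).2 (by lia)) hix.symm

theorem not_isDegreeProfile_of_eq_zero (hd : ∀ i ≠ s, d i = 0) (hs : d s < Fintype.card ι / 2) :
    ¬ IsDegreeProfile R d ρ := by
  classical
  intro hρ
  by_cases hpos : ∀ i ≠ s, 1 ≤ ρ i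
  · exact hρ.false_of_one_le hd hs hpos
  push Not at hpos
  obtain ⟨w, hw, hρw⟩ := hpos
  have : Nontrivial ι := ⟨w, s, hw⟩
  exact hρ.compl.false_of_one_le hd hs fun i hi => hρ.one_le_compl (Nat.lt_one_iff.1 hρw) (hd i hi)

end Single

section Pair

/-- Let `T` be the set of values of a degree profile on the vertices without neighbours in the
stable set. The values `P` at those that are joined in the first colour to a vertex with one
neighbour in the stable set and value `r` satisfy these two conditions. -/
def IsAdmissible (T P : Finset ℕ) (r : ℕ) : Prop :=
  r ∉ P ∧ ∀ x ∈ T \ P, r ≠ x + 1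

instance (T P : Finset ℕ) (r : ℕ) : Decidable (IsAdmissible T P r) :=
  inferInstanceAs (Decidable (_ ∧ _))

-- Two vertices with distinct values contribute at most `c + c'` to the Erdős–Gallai inequality with
-- threshold `m`, because only one of them can have value `r`; this is one less than required.
theorem exists_forall_isAdmissible_card_le :
    ∀ n ∈ Finset.Icc 6 8, ∀ T ∈ (Finset.Ico 1 n).powersetCard (n - 2), ∀ e ∈ Finset.range 2,
      ∃ m ∈ Finset.Icc (n / 2) (n / 2 + 1), ∃ c ∈ Finset.range 4, ∃ c' ∈ Finset.range (c + 1),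
        (∑ x ∈ T with ¬ m ≤ x, x +
          Finset.card {x ∈ T | m ≤ x} * (Finset.card {x ∈ T | m ≤ x} - 1) + (c + c' + 1) =
            ∑ x ∈ T with m ≤ x, x) ∧
        ∃ r ∈ Finset.range n, ∀ P ∈ T.powerset, ∀ a ∈ Finset.range 2,
          IsAdmissible T P (P.card + e + a) →
            Finset.card {x ∈ P | m ≤ x} ≤
              Finset.card {x ∈ P | ¬ m ≤ x} + if P.card + e + a = r then c else c' := by
  decide +kernel

variable {ι : Type*} [Fintype ι] {R : SimpleGraph ι} [DecidableRel R.Adj]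
  {d ρ : ι → ℕ} {s t : ι}

/-- The set of values of `ρ` at the neighbours of `s` in `U`. -/
def neighborValues (R : SimpleGraph ι) [DecidableRel R.Adj] (ρ : ι → ℕ) (U : Finset ι) (s : ι) :
    Finset ℕ :=
  Finset.image ρ {i ∈ U | R.Adj s i}

theorem IsDegreeProfile.ne_of_eq_one (hρ : IsDegreeProfile R d ρ) (hst : s ≠ t) (hs : d s = 1)
    (ht : d t = 1) : ρ s ≠ ρ t := by
  by_cases hadj : R.Adj s t
  · exact hρ.ne_of_adj hadj
  · have := hρ.add_ne_of_not_adj hst hadj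
    lia

theorem IsDegreeProfile.isAdmissible (hρ : IsDegreeProfile R d ρ) {U : Finset ι}
    (hU : ∀ i ∈ U, d i = 0) (hsU : s ∉ U) (hs : d s = 1) :
    IsAdmissible (U.image ρ) (neighborValues R ρ U s) (ρ s) := by
  refine ⟨fun hmem => ?_, fun x hx hxs => ?_⟩
  · obtain ⟨i, hi, his⟩ := Finset.mem_image.1 hmem
    exact hρ.ne_of_adj (Finset.mem_filter.1 hi).2 his.symm
  · obtain ⟨hxT, hxP⟩ := Finset.mem_sdiff.1 hx
    obtain ⟨i, hi, rfl⟩ := Finset.mem_image.1 hxT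
    have hnadj : ¬ R.Adj s i := fun h =>
      hxP (Finset.mem_image_of_mem ρ (Finset.mem_filter.2 ⟨hi, h⟩))
    exact hρ.add_ne_of_not_adj (ne_of_mem_of_not_mem hi hsU).symm hnadj (by rw [hxs, hU i hi, hs])

variable [DecidableEq ι]

theorem IsDegreeProfile.sum_image_add_le (hρ : IsDegreeProfile R d ρ) {U : Finset ι}
    (hU : ∀ i ∈ U, d i = 0) (m : ℕ) :
    ∑ x ∈ U.image ρ with m ≤ x, x +
        ∑ s ∈ Uᶜ, Finset.card {x ∈ neighborValues R ρ U s | ¬ m ≤ x} ≤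
      ∑ x ∈ U.image ρ with ¬ m ≤ x, x +
        Finset.card {x ∈ U.image ρ | m ≤ x} * (Finset.card {x ∈ U.image ρ | m ≤ x} - 1) +
        ∑ s ∈ Uᶜ, Finset.card {x ∈ neighborValues R ρ U s | m ≤ x} := by
  have hfilter (s) : ∀ i ∈ U.filter (R.Adj s), d i = 0 := fun i hi =>
    hU i (Finset.mem_of_mem_filter i hi)
  have hEG := sum_degree_add_le (R := R) (Finset.disjoint_filter_filter_not U U (m ≤ ρ ·))
  rw [Finset.filter_union_filter_not_eq] at hEG
  simp only [neighborValues, hρ.sum_filter_image hU, hρ.card_filter_image hU,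
    fun s p [DecidablePred p] => hρ.card_filter_image (hfilter s) p]
  simpa only [Finset.filter_comm] using hEG

theorem degree_eq_card_filter_add (hst : s ≠ t) : R.degree s =
    Finset.card {i ∈ ({s, t}ᶜ : Finset ι) | R.Adj s i} + if R.Adj s t then 1 else 0 := by
  rw [← R.card_neighborFinset_eq_degree, R.neighborFinset_eq_filter, Finset.card_filter,
    Finset.card_filter, ← Finset.sum_compl_add_sum {s, t}, Finset.sum_pair hst,
    if_neg (R.irrefl), zero_add]

theorem IsDegreeProfile.exists_eq_card_add (hρ : IsDegreeProfile R d ρ) (hst : s ≠ t)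
    (hd : ∀ i ∈ ({s, t}ᶜ : Finset ι), d i = 0) (hs : d s = 1) : ∃ a ∈ Finset.range 2,
      ρ s = (neighborValues R ρ {s, t}ᶜ s).card + (if R.Adj s t then 1 else 0) + a := by
  rw [neighborValues,
    Finset.card_image_of_injOn (hρ.injOn.mono fun i hi => hd i (Finset.mem_of_mem_filter i hi)),
    ← degree_eq_card_filter_add hst]
  have hle := hρ.degree_le s
  have hle' := hρ.le_degree_add s
  exact ⟨ρ s - R.degree s, Finset.mem_range.2 (by lia), by lia⟩

theorem IsDegreeProfile.image_mem_powersetCard (hρ : IsDegreeProfile R d ρ) (hst : s ≠ t)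
    (hd : ∀ i ∈ ({s, t}ᶜ : Finset ι), d i = 0) (hpos : ∀ i ∈ ({s, t}ᶜ : Finset ι), 1 ≤ ρ i) :
    ({s, t}ᶜ : Finset ι).image ρ ∈
      (Finset.Ico 1 (Fintype.card ι)).powersetCard (Fintype.card ι - 2) := by
  refine Finset.mem_powersetCard.2 ⟨fun x hx => ?_, ?_⟩
  · obtain ⟨i, hi, rfl⟩ := Finset.mem_image.1 hx
    exact Finset.mem_Ico.2
      ⟨hpos i hi, (hρ.eq_degree (hd i hi)).trans_lt (R.degree_lt_card_verts i)⟩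
  · rw [Finset.card_image_of_injOn (hρ.injOn.mono hd), Finset.card_compl, Finset.card_pair hst]

theorem IsDegreeProfile.false_of_pair (hρ : IsDegreeProfile R d ρ) (hst : s ≠ t)
    (hs : d s = 1) (ht : d t = 1) (hd : ∀ i ∈ ({s, t}ᶜ : Finset ι), d i = 0)
    (hcard : Fintype.card ι ∈ Finset.Icc 6 8) (hpos : ∀ i ∈ ({s, t}ᶜ : Finset ι), 1 ≤ ρ i) :
    False := by
  have he : (if R.Adj s t then 1 else 0) ∈ Finset.range 2 := by
    rw [Finset.mem_range]
    split_ifs <;> lia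
  obtain ⟨m, -, c, -, c', hc', hsum, r, -, hr⟩ := exists_forall_isAdmissible_card_le _ hcard _
    (hρ.image_mem_powersetCard hst hd hpos) _ he
  have hEG := hρ.sum_image_add_le hd m
  rw [compl_compl, Finset.sum_pair hst, Finset.sum_pair hst] at hEG
  have hne := hρ.ne_of_eq_one hst hs ht
  have hle {u} (hu : u ∈ ({s, t} : Finset ι)) (hdu : d u = 1) (hρu : ∃ a ∈ Finset.range 2,
      ρ u = (neighborValues R ρ {s, t}ᶜ u).card + (if R.Adj s t then 1 else 0) + a) :
      Finset.card {x ∈ neighborValues R ρ {s, t}ᶜ u | m ≤ x} ≤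
        Finset.card {x ∈ neighborValues R ρ {s, t}ᶜ u | ¬ m ≤ x} + if ρ u = r then c else c' := by
    obtain ⟨a, ha, hua⟩ := hρu
    have hadm := hρ.isAdmissible hd (Finset.notMem_compl.2 hu) hdu
    rw [hua] at hadm ⊢
    exact hr _ (Finset.mem_powerset.2 (Finset.image_subset_image (Finset.filter_subset _ _))) a ha
      hadm
  have hs_le := hle (Finset.mem_insert_self s {t}) hs (hρ.exists_eq_card_add hst hd hs)
  have ht_le := hle (by simp) ht <| by
    have := hρ.exists_eq_card_add hst.symm (by rwa [Finset.pair_comm]) ht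
    rwa [Finset.pair_comm, if_congr (R.adj_comm t s) rfl rfl] at this
  rw [Finset.mem_range] at hc'
  split_ifs at hs_le ht_le <;> lia

theorem not_isDegreeProfile_of_pair (hst : s ≠ t) (hs : d s = 1) (ht : d t = 1)
    (hd : ∀ i ∈ ({s, t}ᶜ : Finset ι), d i = 0) (hcard : Fintype.card ι ∈ Finset.Icc 6 8) :
    ¬ IsDegreeProfile R d ρ := by
  intro hρ
  by_cases hpos : ∀ i ∈ ({s, t}ᶜ : Finset ι), 1 ≤ ρ i
  · exact hρ.false_of_pair hst hs ht hd hcard hpos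
  push Not at hpos
  obtain ⟨w, -, hρw⟩ := hpos
  have : Nontrivial ι := ⟨s, t, hst⟩
  exact hρ.compl.false_of_pair hst hs ht hd hcard fun i hi =>
    hρ.one_le_compl (Nat.lt_one_iff.1 hρw) (hd i hi)

end Pair

section Classification

variable {V : Type*} [Finite V] {G : SimpleGraph V} {Y : Set V}

theorem IsSplitEnum.encard_edgeSet_le {ι : Type*} [Fintype ι] {v : ι → V} {d : ι → ℕ}
    (hG : IsSplitEnum G Y v d) :
    G.edgeSet.encard ≤ ((Fintype.card ι).choose 2 + ∑ i, d i : ℕ) := by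
  classical
  have hsub : G.edgeSet ⊆ Sym2.map v '' (⊤ : SimpleGraph ι).edgeSet ∪
      ⋃ i, (fun y => s(v i, y)) '' (G.neighborSet (v i) ∩ Y) := by
    intro f hf
    rcases hG.exists_eq_of_mem_edgeSet hf with ⟨i, j, rfl⟩ | ⟨i, y, hy, rfl⟩
    · exact .inl ⟨s(i, j), fun h => hf.ne (congrArg v h), rfl⟩
    · exact .inr (Set.mem_iUnion.2 ⟨i, y, ⟨hf, hy⟩, rfl⟩)
  rw [← (Set.toFinite _).cast_ncard_eq, Nat.cast_le]
  refine (Set.ncard_le_ncard hsub).trans <| (Set.ncard_union_le _ _).trans <| Nat.add_le_add ?_ <|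
    (Set.ncard_iUnion_le_of_fintype _).trans <| Finset.sum_le_sum fun i _ => ?_
  · refine (Set.ncard_image_le).trans ?_
    rw [← coe_edgeFinset, Set.ncard_coe_finset, card_edgeFinset_top_eq_card_choose_two]
  · rw [← hG.degreeInto_eq]
    exact Set.ncard_image_le

theorem IsSplitEnum.not_decomposable {ι : Type*} [Fintype ι] {v : ι → V} {d : ι → ℕ}
    (hG : IsSplitEnum G Y v d) {i j : ι} (hij : i ≠ j) (hdij : d i = d j)
    (hcard : (Fintype.card ι).choose 2 + ∑ i, d i ≤ 3) : ¬ G.Decomposable := by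
  refine not_decomposable_of_encard_edgeSet_le
    (hG.encard_edgeSet_le.trans (by exact_mod_cast hcard)) (hG.adj hij) ?_
  rw [hG.ncard_neighborSet_self, hG.ncard_neighborSet_self, hdij]

variable {n : ℕ} {v : Fin n → V} {d : Fin n → ℕ}

theorem IsSplitEnum.irregularlyColorable_two_of_decomposable (hG : IsSplitEnum G Y v d)
    (hd : Antitone d) (hn : 2 ≤ n) (hsum : n / 2 ≤ ∑ i, d i) (hdec : G.Decomposable)
    {i j : Fin n} (hij : i ≠ j) (hdij : d i = d j) : IrregularlyColorable G 2 := by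
  refine hG.irregularlyColorable_two hd hn hsum ?_
  rintro rfl k hk
  refine hG.not_decomposable hij hdij ?_ hdec
  have hone (l) : d l = 1 := by
    have hl : l = i ∨ l = j := by lia
    have hk' : k = i ∨ k = j := by lia
    grind
  simp [hone]

theorem IsSplitEnum.four_le_of_decomposable (hG : IsSplitEnum G Y v d) (hsum : ∑ i, d i < n / 2)
    (hdec : G.Decomposable) {i j : Fin n} (hij : i ≠ j) (hdij : d i = d j) : 4 ≤ n := by
  by_contra hn
  refine hG.not_decomposable hij hdij ?_ hdec
  rw [Fintype.card_fin]
  have := Nat.choose_le_choose 2 (show n ≤ 3 by lia)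
  have : Nat.choose 3 2 = 3 := rfl
  lia

theorem add_add_le_sum (hn : 3 ≤ n) (d : Fin n → ℕ) :
    d ⟨0, by lia⟩ + d ⟨1, by lia⟩ + d ⟨2, by lia⟩ ≤ ∑ i, d i := by
  obtain ⟨m, rfl⟩ := Nat.exists_eq_add_of_le hn
  rw [Fin.sum_univ_add, Fin.sum_univ_three]
  exact Nat.le_add_right _ _

theorem IsSplitEnum.irregularlyColorable_two_of_add_add_eq_three (hG : IsSplitEnum G Y v d)
    (hd : Antitone d) (hn : n = 8 ∨ n = 9)
    (hthree : d ⟨0, by omega⟩ + d ⟨1, by omega⟩ + d ⟨2, by omega⟩ = 3)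
    (hone : 1 ≤ d ⟨1, by omega⟩) : IrregularlyColorable G 2 := by
  rcases le_or_gt (n / 2) (∑ i, d i) with hsum | hsum
  · exact hG.irregularlyColorable_two hd (by lia) hsum (by lia)
  obtain ⟨t, rfl⟩ := Nat.exists_eq_add_of_le (show 4 ≤ n by lia)
  have hzero (i : Fin (4 + t)) (hi : 3 ≤ (i : ℕ)) : d i = 0 := eq_zero_of_sum_le hd (by lia)
  have h01 : d ⟨1, by omega⟩ ≤ d ⟨0, by omega⟩ := hd (Nat.zero_le 1)
  have h12 : d ⟨2, by omega⟩ ≤ d ⟨1, by omega⟩ := hd (Nat.le_succ 1)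
  obtain htwo | htwo : d ⟨2, by omega⟩ = 1 ∨ d ⟨2, by omega⟩ = 0 := by lia
  · have hd' : d = fun i : Fin (4 + t) => if (i : ℕ) < 3 then 1 else 0 := by
      funext ⟨k, hk⟩
      rcases k with _ | _ | _ | k
      · exact (show d ⟨0, hk⟩ = 1 by lia)
      · exact (show d ⟨1, hk⟩ = 1 by lia)
      · exact htwo
      · exact hzero _ (Nat.le_add_left 3 k)
    exact (hd' ▸ hG).irregularlyColorable_two_of_one_one_one (by lia)
  · have hd' : d = fun i : Fin (4 + t) => 2 - (i : ℕ) := by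
      funext ⟨k, hk⟩
      rcases k with _ | _ | _ | k
      · exact (show d ⟨0, hk⟩ = 2 by lia)
      · exact (show d ⟨1, hk⟩ = 1 by lia)
      · exact htwo
      · exact (hzero _ (Nat.le_add_left 3 k)).trans (by simp)
    exact (hd' ▸ hG).irregularlyColorable_two_of_two_one (by lia)

theorem IsSplitEnum.irregularlyColorable_two_of_eq_one_of_eq_one (hG : IsSplitEnum G Y v d)
    (hd : Antitone d) (hn : n = 9) (h0 : d ⟨0, by omega⟩ = 1) (h1 : d ⟨1, by omega⟩ = 1) :
    IrregularlyColorable G 2 := by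
  subst hn
  have h12 : d 2 ≤ d 1 := hd (by decide)
  obtain h2 | h2 : d 2 = 1 ∨ d 2 = 0 := by
    change d 1 = 1 at h1
    lia
  · exact hG.irregularlyColorable_two_of_add_add_eq_three hd (.inr rfl)
      (congrArg₂ (· + ·) (congrArg₂ (· + ·) h0 h1) h2) h1.ge
  · have hd' : d = fun i : Fin 9 => if (i : ℕ) < 2 then 1 else 0 := by
      funext ⟨k, hk⟩
      rcases k with _ | _ | k
      · exact h0
      · exact h1
      · exact Nat.le_zero.1 <| h2 ▸ hd (Fin.le_def.2 (Nat.le_add_left 2 k))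
    exact IsSplitEnum.irregularlyColorable_two_of_one_one (hd' ▸ hG)

theorem IsSplitEnum.not_irregularlyColorable_two (hG : IsSplitEnum G Y v d) (hd : Antitone d)
    (hn4 : 4 ≤ n) (hn9 : n ≤ 9) (hsum : ∑ i, d i < n / 2)
    (hthree : ¬ ∃ h : 8 ≤ n, d ⟨0, by omega⟩ + d ⟨1, by omega⟩ + d ⟨2, by omega⟩ = 3 ∧
      1 ≤ d ⟨1, by omega⟩)
    (hone : ¬ (n = 9 ∧ d ⟨0, by omega⟩ = 1 ∧ d ⟨1, by omega⟩ = 1)) :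
    ¬ IrregularlyColorable G 2 := by
  intro h
  obtain ⟨R, _, ρ, hρ⟩ := hG.exists_isDegreeProfile h
  have hle := add_add_le_sum (show 3 ≤ n by lia) d
  have h01 : d ⟨1, by omega⟩ ≤ d ⟨0, by omega⟩ := hd (Nat.zero_le 1)
  have h12 : d ⟨2, by omega⟩ ≤ d ⟨1, by omega⟩ := hd (Nat.le_succ 1)
  rcases Nat.eq_zero_or_pos (d ⟨1, by omega⟩) with h1 | h1
  · refine not_isDegreeProfile_of_eq_zero (s := ⟨0, by omega⟩) (fun i hi => ?_) ?_ hρ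
    · have hi' : (⟨1, by omega⟩ : Fin n) ≤ i := Nat.one_le_iff_ne_zero.2 fun h => hi (Fin.ext h)
      exact Nat.le_zero.1 (h1 ▸ hd hi')
    · rw [Fintype.card_fin]
      lia
  · have h8 (h8 : 8 ≤ n) : d ⟨0, by omega⟩ + d ⟨1, by omega⟩ + d ⟨2, by omega⟩ ≠ 3 :=
      fun h3 => hthree ⟨h8, h3, h1⟩
    have h2 : d ⟨2, by omega⟩ = 0 := by lia
    refine not_isDegreeProfile_of_pair (s := ⟨0, by omega⟩) (t := ⟨1, by omega⟩)
      (Fin.ne_of_val_ne zero_ne_one) (by lia) (by lia) (fun i hi => ?_) ?_ hρ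
    · have hi' : (⟨2, by omega⟩ : Fin n) ≤ i := by
        simp only [Finset.mem_compl, Finset.mem_insert, Finset.mem_singleton, Fin.ext_iff] at hi
        rw [Fin.le_def]
        lia
      exact Nat.le_zero.1 (h2 ▸ hd hi')
    · rw [Fintype.card_fin, Finset.mem_Icc]
      lia

end Classification

end LocallyIrregular

open LocallyIrregular

/-- The vertices `v_1, …, v_n` of the clique are `v 0, …, v (n-1)`, and `d_i` is `d (i-1)`. -/
theorem theorem2 {V : Type*} [Finite V] (G : SimpleGraph V) (X Y : Set V) (hG : G.IsSplit X Y)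
    (n : ℕ) (hn2 : 2 ≤ n) (hn9 : n ≤ 9)
    (v : Fin n → V) (hv : Function.Injective v) (hX : Set.range v = X)
    (d : Fin n → ℕ) (hd : ∀ i, d i = G.degreeInto (v i) Y) (hanti : Antitone d) :
    ((Nonempty (G ≃g SimpleGraph.completeGraph (Fin 2)) ∨
        Nonempty (G ≃g SimpleGraph.completeGraph (Fin 3)) ∨
        Nonempty (G ≃g SimpleGraph.pathGraph 4)) → ¬ G.Decomposable) ∧
    (G.Decomposable →
      (StrictAnti d → G.irregularChromaticIndex = 1) ∧
      (¬ StrictAnti d →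
        (n / 2 ≤ ∑ i, d i → G.irregularChromaticIndex = 2) ∧
        ((∃ h : 8 ≤ n, d ⟨0, by omega⟩ + d ⟨1, by omega⟩ + d ⟨2, by omega⟩ = 3 ∧
            1 ≤ d ⟨1, by omega⟩) → G.irregularChromaticIndex = 2) ∧
        (n = 9 ∧ d ⟨0, by omega⟩ = 1 ∧ d ⟨1, by omega⟩ = 1 → G.irregularChromaticIndex = 2) ∧
        (¬ (n / 2 ≤ ∑ i, d i) →
          ¬ (∃ h : 8 ≤ n, d ⟨0, by omega⟩ + d ⟨1, by omega⟩ + d ⟨2, by omega⟩ = 3 ∧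
            1 ≤ d ⟨1, by omega⟩) →
          ¬ (n = 9 ∧ d ⟨0, by omega⟩ = 1 ∧ d ⟨1, by omega⟩ = 1) →
          G.irregularChromaticIndex = 3))) := by
  obtain rfl := hX
  have hG' : IsSplitEnum G Y v d := ⟨hG, hv, fun i => (hd i).symm⟩
  refine ⟨not_decomposable_of_iso_small, fun hdec => ⟨fun hlt => ?_, fun hlt => ?_⟩⟩
  · have hadj := hG'.adj (i := ⟨0, by omega⟩) (j := ⟨1, by omega⟩) (by simp)
    exact irregularChromaticIndex_eq (hG'.irregularlyColorable_one hlt.injective)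
      (not_irregularlyColorable_zero hadj)
  obtain ⟨i, j, hdij, hij⟩ :=
    Function.not_injective_iff.1 fun h => hlt (hanti.strictAnti_of_injective h)
  have htwo (h : IrregularlyColorable G 2) : G.irregularChromaticIndex = 2 :=
    irregularChromaticIndex_eq h (hG'.not_irregularlyColorable_one hij hdij)
  refine ⟨fun hsum => htwo ?_, fun ⟨h8, h3, h1⟩ => htwo ?_, fun ⟨h9, h0, h1⟩ => htwo ?_,
    fun hsum hc hd => ?_⟩
  · exact hG'.irregularlyColorable_two_of_decomposable hanti hn2 hsum hdec hij hdij
  · exact hG'.irregularlyColorable_two_of_add_add_eq_three hanti (by lia) h3 h1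
  · exact hG'.irregularlyColorable_two_of_eq_one_of_eq_one hanti h9 h0 h1
  · have hn4 := hG'.four_le_of_decomposable (not_le.1 hsum) hdec hij hdij
    exact irregularChromaticIndex_eq (hG'.irregularlyColorable_three hanti hn4 (not_le.1 hsum))
      (hG'.not_irregularlyColorable_two hanti hn4 hn9 (not_le.1 hsum) hc hd)
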